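/- Let $\Omega\subset\mathbb R^n$ be a bounded Lipschitz domain with a finite partition $\mathcal T_h$ into non-overlapping Lipschitz subdomains $K$. Write $(\cdot,\cdot)_\Omega$, $(\cdot,\cdot)_{\mathcal T_h}=\sum_K(\cdot,\cdot)_K$ for $L^2$ inner products of differential forms and $\langle\cdot,\cdot\rangle_{\partial\mathcal T_h}=\sum_K\langle\cdot,\cdot\rangle_{L^2\Lambda(\partial K)}$; $d$ and its formal adjoint $\delta$ are taken in the sense of distributions, and $w^{\tan},w^{\rm nor}$ are the weak tangential and normal traces on $\partial K$, for which $\langle w^{\tan},v^{\rm nor}\rangle_{\partial K}=(dw,v)_K-(w,\delta v)_K$. For each $K$ let $W_h(K)=\bigoplus_jW_h^j(K)$ be a finite-dimensional graded subcomplex of $H\Lambda(K)$, contained in $H^*\Lambda(K)$, all of whose elements have tangential and normal traces in $L^2\Lambda(\partial K)$. Put $W_h^j=\prod_KW_h^j(K)\subset L^2\Lambda^j(\Omega)$, $\widehat W_h^{j,\rm nor}=\{w^{\tan}:w\in W_h^j\}$, let $\mathring V_h^j\subset W_h^j$ be the subspace of forms whose tangential jump vanishes on all of $\bigcup_K\partial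 K$ (the jump on $\partial\Omega$ being the trace itself), and let $\mathring V_h^{j,\tan}=\{w^{\tan}:w\in\mathring V_h^j\}$. Let $0\le k\le n$, let $I\subset\mathbb R$ be an interval with more than one point, and let $F:I\times\Omega\times\mathrm{Alt}^k\mathbb R^n\to\mathbb R$ be regular enough on $W_h^k$ in the following sense: for all $t\in I$ and $u,v\in W_h^k$, $F(t,x,\cdot)$ is differentiable for a.e. $x$, $F(t,\cdot,u)\in L^1(\Omega)$, $f(t,u):=\frac{\partial F}{\partial u}(t,\cdot,u)\in L^2\Lambda^k(\Omega)$, and $|(\frac{\partial F}{\partial u}(t,x,u+sv),v)|$ is bounded, for all small $|s|$, by an integrable function of $x$. Consider the following methods for the $k$-form semilinear Hodge wave equation $\ddot u+(d\delta+\delta d)u=-\partial F/\partial u$, with homogeneous Dirichlet conditions, for unknowns depending on $t\in I$ (differentiable in $t$ where a time derivative occurs; all equations are for all $t\in I$). *Conforming AFW method*, with $\sigma_h\in\mathring V_h^{k-1}$, $u_h,p_h\in\mathring V_h^k$, $\rho_h\in\mathring V_h^{k+1}$. First formulation: $$(\dot u_h,r)_\Omega=(p_h,r)_\Omega\ \ \forall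 r\in\mathring V_h^k,\qquad-(\dot p_h,v)_\Omega+(d\sigma_h,v)_\Omega+(\rho_h,dv)_\Omega=(f(t,u_h),v)_\Omega\ \ \forall v\in\mathring V_h^k,\tag{1}$$ $$(u_h,d\tau)_\Omega=-(\sigma_h,\tau)_\Omega\ \ \forall\tau\in\mathring V_h^{k-1},\qquad(du_h,\eta)_\Omega=-(\rho_h,\eta)_\Omega\ \ \forall\eta\in\mathring V_h^{k+1}.\tag{2}$$ Second formulation: (1) with $(\dot\sigma_h,\tau)_\Omega+(p_h,d\tau)_\Omega=0$ for all $\tau\in\mathring V_h^{k-1}$ and $(\dot\rho_h,\eta)_\Omega+(dp_h,\eta)_\Omega=0$ for all $\eta\in\mathring V_h^{k+1}$, and with (2) imposed at an initial time $t_0\in I$ only. *Hybrid AFW-H method*, with $\sigma_h\in W_h^{k-1}$, $u_h,p_h\in W_h^k$, $\rho_h\in W_h^{k+1}$ and traces $\hat\sigma_h^{\tan}\in\mathring V_h^{k-1,\tan}$, $\hat u_h^{\tan},\hat p_h^{\tan}\in\mathring V_h^{k,\tan}$, $\hat u_h^{\rm nor},\hat p_h^{\rm nor}\in\widehat W_h^{k-1,\rm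 nor}$, $\hat\rho_h^{\rm nor}\in\widehat W_h^{k,\rm nor}$: (a) $(\dot\sigma_h,\tau)_{\mathcal T_h}+(p_h,d\tau)_{\mathcal T_h}-\langle\hat p_h^{\rm nor},\tau^{\tan}\rangle_{\partial\mathcal T_h}=0$ for all $\tau\in W_h^{k-1}$; (b) $(\dot u_h,r)_{\mathcal T_h}=(p_h,r)_{\mathcal T_h}$ for all $r\in W_h^k$; (c) $(\dot\rho_h,\eta)_{\mathcal T_h}+(p_h,\delta\eta)_{\mathcal T_h}+\langle\hat p_h^{\tan},\eta^{\rm nor}\rangle_{\partial\mathcal T_h}=0$ for all $\eta\in W_h^{k+1}$; (d) $(u_h,d\tau)_{\mathcal T_h}-\langle\hat u_h^{\rm nor},\tau^{\tan}\rangle_{\partial\mathcal T_h}=-(\sigma_h,\tau)_{\mathcal T_h}$ for all $\tau\in W_h^{k-1}$; (e) $-(\dot p_h,v)_{\mathcal T_h}+(\sigma_h,\delta v)_{\mathcal T_h}+(\rho_h,dv)_{\mathcal T_h}+\langle\hat\sigma_h^{\tan},v^{\rm nor}\rangle_{\partial\mathcal T_h}-\langle\hat\rho_h^{\rm nor},v^{\tan}\rangle_{\partial\mathcal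 T_h}=(f(t,u_h),v)_\Omega$ for all $v\in W_h^k$; (f) $(u_h,\delta\eta)_{\mathcal T_h}+\langle\hat u_h^{\tan},\eta^{\rm nor}\rangle_{\partial\mathcal T_h}=-(\rho_h,\eta)_{\mathcal T_h}$ for all $\eta\in W_h^{k+1}$; (g) flux conditions $\langle\hat w_h^{\tan}-w_h^{\tan},\hat v\rangle_{\partial\mathcal T_h}=0$ for all $\hat v\in\widehat W_h^{j,\rm nor}$, for $w=\sigma$ ($j=k-1$) and $w=u,p$ ($j=k$); (h) conservativity $\langle\hat w_h^{\rm nor},\hat v\rangle_{\partial\mathcal T_h}=0$ for all $\hat v\in\mathring V_h^{j,\tan}$, for $w=u,p$ ($j=k-1$) and $w=\rho$ ($j=k$). The full method consists of (a)–(h) together with $\frac{d}{dt}\hat u_h^{\tan}=\hat p_h^{\tan}$ and $\frac{d}{dt}\hat u_h^{\rm nor}=\hat p_h^{\rm nor}$. Its first implementation consists of (b), (d), (e), (f) and the parts of (g), (h) for $\sigma,u,\rho$. Its second implementation consists of (a), (b), (c), (e) and the parts of (g), (h) for $\sigma,p,\rho$, with (d), (f) and the parts of (g), (h) for $u$ imposed,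 for some admissible $\hat u_h^{\tan},\hat u_h^{\rm nor}$, at an initial time $t_0\in I$ only. **Statement.** $\mathring V_h^j\subset H\Lambda(\Omega)$ for all $j$, and for each $u_h\in\mathring V_h^k$ the constraints (2) have unique solutions $\sigma_h=\sigma_h(u_h)\in\mathring V_h^{k-1}$ and $\rho_h=\rho_h(u_h)\in\mathring V_h^{k+1}$. Define $$\mathcal H_h(t,u_h,p_h)=\tfrac12\bigl(\|\sigma_h\|_\Omega^2+\|p_h\|_\Omega^2+\|\rho_h\|_\Omega^2\bigr)+\int_\Omega F(t,x,u_h)\,dx,\qquad(u_h,p_h)\in\mathring V_h^k\times\mathring V_h^k.$$ For time-dependent $(\sigma_h,u_h,\rho_h,p_h)$ the following are equivalent: it solves the conforming AFW method in the first formulation; it solves it in the second formulation (for any $t_0\in I$); together with some trace variables it solves the full AFW-H method; the same for the first implementation; the same for the second implementation (for any $t_0\in I$); and: $(u_h,p_h)$ takes values in $\mathring V_h^k\times\mathring V_h^k$, is differentiable and satisfies Hamilton's equations $$-(\dot p_h,v)_\Omega+(\dot u_h,r)_\Omega=\frac{d}{d\epsilon}\Big|_{\epsilon=0}\mathcal H_h(t,u_h+\epsilon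 v,p_h+\epsilon r)\qquad\forall v,r\in\mathring V_h^k,\ t\in I,$$ while $\sigma_h(t)=\sigma_h(u_h(t))$ and $\rho_h(t)=\rho_h(u_h(t))$ for $t\in I$. Moreover, the trace variables of a solution of the full AFW-H method are uniquely determined by $(\sigma_h,u_h,\rho_h,p_h)$. -/

import Mathlib

open Set Filter Topology MeasureTheory
open scoped ContDiff RealInnerProductSpace

namespace HodgeWave

/-! ### The exterior algebra of `ℝⁿ` -/

/-- Euclidean space `ℝⁿ`. -/
abbrev Space (n : ℕ) : Type := EuclideanSpace ℝ (Fin n)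

/-- `Altʲ ℝⁿ`. -/
abbrev AltK (n j : ℕ) : Type := Space n [⋀^Fin j]→L[ℝ] ℝ

/-- `Alt ℝⁿ = ⨁_{j = 0}^{n} Altʲ ℝⁿ`. -/
abbrev Alt (n : ℕ) : Type := (j : Fin (n + 1)) → AltK n (j : ℕ)

variable {n : ℕ}

/-- The inner product on `Alt ℝⁿ` induced by the Euclidean one: different degrees are orthogonal and
the `dx^{i₁} ∧ ⋯ ∧ dx^{iⱼ}`, `i₁ < ⋯ < iⱼ`, are orthonormal.  (Each increasing multi-index is counted
`j!` times in the sum over all multi-indices.) -/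
noncomputable def altInner (a b : Alt n) : ℝ :=
  ∑ j : Fin (n + 1), ((j : ℕ).factorial : ℝ)⁻¹ *
    ∑ v : Fin (j : ℕ) → Fin n,
      a j (fun i => EuclideanSpace.single (v i) (1 : ℝ)) *
        b j (fun i => EuclideanSpace.single (v i) (1 : ℝ))

/-- The wedge product `ξ♭ ∧ a` of the covector `⟪ξ, ·⟫` with `a`, that is
`(ξ♭ ∧ a)(v₀, …, vⱼ) = ∑ (-1)ⁱ ⟪ξ, vᵢ⟫ a(v₀, …, v̂ᵢ, …, vⱼ)`. -/
noncomputable def wedge (ξ : Space n) (a : Alt n) : Alt n := fun j =>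
  Fin.cases (motive := fun j : Fin (n + 1) => AltK n (j : ℕ)) 0
    (fun i => ContinuousAlternatingMap.alternatizeUncurryFin
      ((innerSL ℝ ξ).smulRight (a i.castSucc))) j

/-- The contraction (interior product) `ι_ξ a = a(ξ, ·, …, ·)`. -/
noncomputable def contract (ξ : Space n) (a : Alt n) : Alt n := fun j =>
  if h : (j : ℕ) + 1 < n + 1 then
    ContinuousAlternatingMap.curryLeft (a ⟨(j : ℕ) + 1, h⟩) ξ
  else 0

/-! ### Exterior calculus -/

/-- The exterior differential of a smooth form. -/
noncomputable def dSmooth (φ : Space n → Alt n) (x : Space n) : Alt n := fun j =>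
  Fin.cases (motive := fun j : Fin (n + 1) => AltK n (j : ℕ)) 0
    (fun i => extDeriv (fun y => φ y i.castSucc) x) j

/-- The codifferential of a smooth form, `δ φ = - ∑ᵢ ι_{eᵢ} ∂ᵢ φ`; it is the formal adjoint
`(-1)ʲ ⋆⁻¹ d ⋆` of `d`. -/
noncomputable def deltaSmooth (φ : Space n → Alt n) (x : Space n) : Alt n :=
  -∑ i : Fin n, contract (EuclideanSpace.single i (1 : ℝ))
    (fderiv ℝ φ x (EuclideanSpace.single i (1 : ℝ)))

/-- Smooth compactly supported forms on `ℝⁿ`.  Their restrictions to a bounded set `K` are the forms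
that are smooth up to the boundary of `K`. -/
def IsTestForm (φ : Space n → Alt n) : Prop := ContDiff ℝ ∞ φ ∧ HasCompactSupport φ

/-- `L²Λ(U)`. -/
abbrev L2 (U : Set (Space n)) : Type := Lp (Alt n) 2 ((volume : Measure (Space n)).restrict U)

/-- The `L²` inner product `(w, v)_U` of forms on `U`. -/
noncomputable def ip (U : Set (Space n)) (w v : Space n → Alt n) : ℝ :=
  ∫ x in U, altInner (w x) (v x)

/-- Restriction `L²Λ(U) → L²Λ(V)` for `V ⊆ U`. -/
noncomputable def restr {U : Set (Space n)} (V : Set (Space n)) (w : L2 U) : L2 V := by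
  classical
  exact if h : V ⊆ U then
    ((Lp.memLp w).mono_measure (Measure.restrict_mono h le_rfl)).toLp w else 0

/-- `w` is homogeneous of degree `j`.  (If `j < 0` or `j > n` this forces `w = 0`.) -/
def IsHomogeneous {U : Set (Space n)} (j : ℤ) (w : L2 U) : Prop :=
  ∀ᵐ x ∂((volume : Measure (Space n)).restrict U), ∀ i : Fin (n + 1), ((i : ℕ) : ℤ) ≠ j → w x i = 0

/-- `d w = η` on `U` in the sense of distributions. -/
def HasWeakD {U : Set (Space n)} (w η : L2 U) : Prop :=
  ∀ φ : Space n → Alt n, IsTestForm φ → tsupport φ ⊆ U → ip U w (deltaSmooth φ) = ip U η φ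

/-- `δ w = η` on `U` in the sense of distributions. -/
def HasWeakDelta {U : Set (Space n)} (w η : L2 U) : Prop :=
  ∀ φ : Space n → Alt n, IsTestForm φ → tsupport φ ⊆ U → ip U w (dSmooth φ) = ip U η φ

/-- `w ∈ HΛ(U)`. -/
def InH {U : Set (Space n)} (w : L2 U) : Prop := ∃ η : L2 U, HasWeakD w η

/-- `w ∈ H*Λ(U)`. -/
def InHStar {U : Set (Space n)} (w : L2 U) : Prop := ∃ η : L2 U, HasWeakDelta w η

/-- The distributional exterior differential of `w ∈ HΛ(U)`. -/
noncomputable def weakD {U : Set (Space n)} (w : L2 U) : L2 U := by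
  classical
  exact if h : InH w then h.choose else 0

/-- The distributional codifferential of `w ∈ H*Λ(U)`. -/
noncomputable def weakDelta {U : Set (Space n)} (w : L2 U) : L2 U := by
  classical
  exact if h : InHStar w then h.choose else 0

/-! ### Lipschitz boundaries and traces -/

/-- `K` is open and, near each boundary point, it is the part of a neighbourhood that lies below the
graph of a Lipschitz function over the hyperplane orthogonal to some unit vector `e`. -/
def IsLipschitzOpen (K : Set (Space n)) : Prop :=
  IsOpen K ∧ ∀ x ∈ frontier K, ∃ e : Space n, ‖e‖ = 1 ∧
    ∃ (U : Set (Space n)) (γ : Space n → ℝ) (C : NNReal), U ∈ 𝓝 x ∧ LipschitzWith C γ ∧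
      ∀ y ∈ U, (y ∈ K ↔ ⟪y, e⟫ < γ (y - ⟪y, e⟫ • e))

/-- `ν` is the outward unit normal of `K` at `x`: the boundary has the tangent plane `ν^⊥` at `x`,
with `K` on the side of `-ν` and the complement of `K` on the side of `ν`. -/
def IsOuterNormal (K : Set (Space n)) (x ν : Space n) : Prop :=
  ‖ν‖ = 1 ∧ ∀ ε : ℝ, 0 < ε → ∀ᶠ y in 𝓝 x,
    (⟪y - x, ν⟫ < -(ε * ‖y - x‖) → y ∈ K) ∧ (ε * ‖y - x‖ < ⟪y - x, ν⟫ → y ∉ K)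

/-- The outward unit normal (`0` where there is none, which on a Lipschitz boundary happens only on a
set of surface measure zero). -/
noncomputable def outerNormal (K : Set (Space n)) (x : Space n) : Space n := by
  classical
  exact if h : ∃ ν, IsOuterNormal K x ν then h.choose else 0

/-- Surface measure on `∂K`. -/
noncomputable def surf (K : Set (Space n)) : Measure (Space n) := μHE[n - 1].restrict (frontier K)

/-- Square-integrable `Alt ℝⁿ`-valued functions on `∂K`.  A form on `∂K` is regarded as such a
function with values in the forms annihilated by `ι_ν`, see `IsTangential`. -/
abbrev L2B (K : Set (Space n)) : Type := Lp (Alt n) 2 (surf K)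

/-- `g ∈ L²Λ(∂K)`: `g` equals its tangential part `ι_ν (ν ∧ g)`. -/
def IsTangential {K : Set (Space n)} (g : L2B K) : Prop :=
  ∀ᵐ x ∂(surf K), g x = contract (outerNormal K x) (wedge (outerNormal K x) (g x))

/-- The `L²` inner product `⟨g, h⟩_{∂K}`. -/
noncomputable def ipB (K : Set (Space n)) (g h : Space n → Alt n) : ℝ :=
  ∫ x, altInner (g x) (h x) ∂(surf K)

/-- `w ∈ HΛ(K)` has the weak tangential trace `g ∈ L²Λ(∂K)`: integration by parts holds against all
forms `φ` that are smooth up to the boundary, the normal trace of such a `φ` being `ι_ν φ`. -/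
def HasTanTrace {K : Set (Space n)} (w : L2 K) (g : L2B K) : Prop :=
  InH w ∧ IsTangential g ∧ ∀ φ : Space n → Alt n, IsTestForm φ →
    ipB K g (fun x => contract (outerNormal K x) (φ x)) =
      ip K (weakD w) φ - ip K w (deltaSmooth φ)

/-- `v ∈ H*Λ(K)` has the weak normal trace `h ∈ L²Λ(∂K)`: integration by parts
`⟨wᵗᵃⁿ, h⟩ = (d w, v) - (w, δ v)` holds against all `w ∈ HΛ(K)` with tangential trace in
`L²Λ(∂K)`. -/
def HasNorTrace {K : Set (Space n)} (v : L2 K) (h : L2B K) : Prop :=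
  InHStar v ∧ IsTangential h ∧ ∀ (w : L2 K) (g : L2B K), HasTanTrace w g →
    ipB K g h = ip K (weakD w) v - ip K w (weakDelta v)

/-- The tangential trace. -/
noncomputable def tanTrace {K : Set (Space n)} (w : L2 K) : L2B K := by
  classical
  exact if h : ∃ g, HasTanTrace w g then h.choose else 0

/-- The normal trace. -/
noncomputable def norTrace {K : Set (Space n)} (v : L2 K) : L2B K := by
  classical
  exact if h : ∃ g, HasNorTrace v g then h.choose else 0

/-! ### Meshes and finite element spaces -/

variable {ι : Type*} [Fintype ι]

/-- `(K i)` is a partition of the bounded Lipschitz domain `Ω` into non-overlapping Lipschitz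
subdomains. -/
structure IsMesh (Ω : Set (Space n)) (K : ι → Set (Space n)) : Prop where
  bounded : Bornology.IsBounded Ω
  lipschitz : IsLipschitzOpen Ω
  lipschitz_elem : ∀ i, IsLipschitzOpen (K i)
  subset : ∀ i, K i ⊆ Ω
  disjoint : Pairwise fun i j => Disjoint (K i) (K j)
  cover : Ω ⊆ ⋃ i, closure (K i)

/-- The local spaces `W i j = W_hʲ(K i)`, `j ∈ ℤ`: a finite-dimensional graded subcomplex
`⨁ⱼ W i j` of `HΛ(K i)`, contained in `H*Λ(K i)`, with tangential and normal traces in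
`L²Λ(∂K i)`. -/
structure IsLocalComplex (K : ι → Set (Space n))
    (W : (i : ι) → ℤ → Submodule ℝ (L2 (K i))) : Prop where
  finite : ∀ i j, FiniteDimensional ℝ (W i j)
  homogeneous : ∀ i j, ∀ w ∈ W i j, IsHomogeneous j w
  inH : ∀ i j, ∀ w ∈ W i j, InH w
  inHStar : ∀ i j, ∀ w ∈ W i j, InHStar w
  subcomplex : ∀ i j, ∀ w ∈ W i j, weakD w ∈ W i (j + 1)
  tan_mem : ∀ i j, ∀ w ∈ W i j, ∃ g : L2B (K i), HasTanTrace w g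
  nor_mem : ∀ i j, ∀ w ∈ W i j, ∃ h : L2B (K i), HasNorTrace w h

section Mesh

variable {Ω : Set (Space n)} (K : ι → Set (Space n))

/-- The broken restriction, differential, codifferential and traces of a form on `Ω`. -/
noncomputable def res (w : L2 Ω) : (i : ι) → L2 (K i) := fun i => restr (K i) w

noncomputable def dT (w : L2 Ω) : (i : ι) → L2 (K i) := fun i => weakD (restr (K i) w)

noncomputable def deltaT (w : L2 Ω) : (i : ι) → L2 (K i) := fun i => weakDelta (restr (K i) w)

noncomputable def tanT (w : L2 Ω) : (i : ι) → L2B (K i) := fun i => tanTrace (restr (K i) w)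

noncomputable def norT (w : L2 Ω) : (i : ι) → L2B (K i) := fun i => norTrace (restr (K i) w)

variable {K}

/-- `(w, v)_{𝒯_h} = ∑_K (w, v)_K`. -/
noncomputable def ipT (w v : (i : ι) → L2 (K i)) : ℝ := ∑ i, ip (K i) (w i) (v i)

/-- `⟨g, h⟩_{∂𝒯_h} = ∑_K ⟨g, h⟩_{∂K}`. -/
noncomputable def ipBT (g h : (i : ι) → L2B (K i)) : ℝ := ∑ i, ipB (K i) (g i) (h i)

/-- The tangential jump `∑_K ν_K ∧ g_K` vanishes on the whole skeleton `⋃ ∂K`.  On an interior facet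
this says that the two tangential traces agree, and on `∂Ω` it says that the trace is zero. -/
def NoJump (g : (i : ι) → L2B (K i)) : Prop :=
  ∀ᵐ x ∂((μHE[n - 1] : Measure (Space n)).restrict (⋃ i, frontier (K i))),
    ∑ i, (frontier (K i)).indicator (fun y => wedge (outerNormal (K i) y) (g i y)) x = 0

variable (Ω) (W : (i : ι) → ℤ → Submodule ℝ (L2 (K i)))

/-- The broken space `W_hʲ = ∏_K W_hʲ(K)`, as a subset of `L²Λ(Ω)`. -/
def broken (j : ℤ) : Set (L2 Ω) := {w | ∀ i, restr (K i) w ∈ W i j}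

/-- The conforming space `V̊_hʲ`: broken forms with vanishing tangential jump. -/
def conf (j : ℤ) : Set (L2 Ω) := {w | w ∈ broken Ω W j ∧ NoJump (tanT K w)}

variable {Ω}

/-- The trace space `Ŵ_h^{j,nor} = Ŵ_h^{j,tan} = W_h^{j,tan}`. -/
def traceSpace (j : ℤ) : Set ((i : ι) → L2B (K i)) :=
  {g | ∀ i, ∃ w ∈ W i j, tanTrace w = g i}

/-- The single-valued trace space with zero boundary values. -/
def confTrace (j : ℤ) : Set ((i : ι) → L2B (K i)) := {g | g ∈ traceSpace W j ∧ NoJump g}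

end Mesh

/-! ### The potential and the source term -/

/-- A potential `F(t, x, u)` on `k`-forms. -/
abbrev Potential (n : ℕ) (k : Fin (n + 1)) : Type := ℝ → Space n → AltK n (k : ℕ) → ℝ

/-- `(f(t, u), v)_Ω` with `f(t, u) = ∂F/∂u`, i.e. `∫_Ω ∂F/∂u (t, x, u(x)) v(x) dx`. -/
noncomputable def source {k : Fin (n + 1)} (F : Potential n k) {Ω : Set (Space n)} (t : ℝ)
    (u v : L2 Ω) : ℝ :=
  ∫ x in Ω, fderiv ℝ (F t x) (u x k) (v x k)

/-- `F` is regular enough for `f(t, u_h) = ∂F/∂u_h` to be an `L²` form that is the derivative of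
`u_h ↦ ∫_Ω F(t, x, u_h)` on the discrete space `S`. -/
structure IsRegularPotential {k : Fin (n + 1)} (F : Potential n k) (I : Set ℝ)
    {Ω : Set (Space n)} (S : Set (L2 Ω)) : Prop where
  differentiable : ∀ t ∈ I, ∀ᵐ x ∂((volume : Measure (Space n)).restrict Ω),
    Differentiable ℝ (F t x)
  integrable : ∀ t ∈ I, ∀ u ∈ S, IntegrableOn (fun x => F t x (u x k)) Ω
  source_mem : ∀ t ∈ I, ∀ u ∈ S,
    MemLp (fun x => fderiv ℝ (F t x) (u x k)) 2 ((volume : Measure (Space n)).restrict Ω)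
  dominated : ∀ t ∈ I, ∀ u ∈ S, ∀ v ∈ S, ∃ ε : ℝ, 0 < ε ∧ ∃ b : Space n → ℝ, IntegrableOn b Ω ∧
    ∀ᵐ x ∂((volume : Measure (Space n)).restrict Ω), ∀ s : ℝ, |s| < ε →
      |fderiv ℝ (F t x) (u x k + s • v x k) (v x k)| ≤ b x

/-! ### The methods -/

/-- The interior unknowns `σ_h, u_h, ρ_h, p_h` as functions of time. -/
structure Curves (Ω : Set (Space n)) where
  σ : ℝ → L2 Ω
  u : ℝ → L2 Ω
  ρ : ℝ → L2 Ω
  p : ℝ → L2 Ω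

/-- The trace unknowns `σ̂ᵗᵃⁿ, ûᵗᵃⁿ, p̂ᵗᵃⁿ, ûⁿᵒʳ, p̂ⁿᵒʳ, ρ̂ⁿᵒʳ` as functions of time. -/
structure TraceCurves (K : ι → Set (Space n)) where
  σt : ℝ → (i : ι) → L2B (K i)
  ut : ℝ → (i : ι) → L2B (K i)
  pt : ℝ → (i : ι) → L2B (K i)
  un : ℝ → (i : ι) → L2B (K i)
  pn : ℝ → (i : ι) → L2B (K i)
  ρn : ℝ → (i : ι) → L2B (K i)

section Methods

variable {Ω : Set (Space n)} {K : ι → Set (Space n)} (W : (i : ι) → ℤ → Submodule ℝ (L2 (K i)))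
  (k : Fin (n + 1))

/-! #### The equations of the hybrid method at one instant -/

/-- `(u̇, r) = (p, r)` for all `r ∈ W_hᵏ`. -/
def EqU (u' p : L2 Ω) : Prop :=
  ∀ r ∈ broken Ω W (k : ℕ), ipT (res K u') (res K r) = ipT (res K p) (res K r)

/-- `-(ṗ, v) + (σ, δv) + (ρ, dv) + ⟨σ̂ᵗᵃⁿ, vⁿᵒʳ⟩ - ⟨ρ̂ⁿᵒʳ, vᵗᵃⁿ⟩ = (f(t, u), v)` for all
`v ∈ W_hᵏ`. -/
def EqP (F : Potential n k) (t : ℝ) (u p' σ ρ : L2 Ω) (σt ρn : (i : ι) → L2B (K i)) : Prop :=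
  ∀ v ∈ broken Ω W (k : ℕ),
    -ipT (res K p') (res K v) + ipT (res K σ) (deltaT K v) + ipT (res K ρ) (dT K v)
      + ipBT σt (norT K v) - ipBT ρn (tanT K v) = source F t u v

/-- `(u, dτ) - ⟨ûⁿᵒʳ, τᵗᵃⁿ⟩ = -(σ, τ)` for all `τ ∈ W_hᵏ⁻¹`. -/
def EqTau (u σ : L2 Ω) (un : (i : ι) → L2B (K i)) : Prop :=
  ∀ τ ∈ broken Ω W ((k : ℕ) - 1),
    ipT (res K u) (dT K τ) - ipBT un (tanT K τ) = -ipT (res K σ) (res K τ)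

/-- `(u, δη) + ⟨ûᵗᵃⁿ, ηⁿᵒʳ⟩ = -(ρ, η)` for all `η ∈ W_hᵏ⁺¹`. -/
def EqEta (u ρ : L2 Ω) (ut : (i : ι) → L2B (K i)) : Prop :=
  ∀ η ∈ broken Ω W ((k : ℕ) + 1),
    ipT (res K u) (deltaT K η) + ipBT ut (norT K η) = -ipT (res K ρ) (res K η)

/-- `(σ̇, τ) + (p, dτ) - ⟨p̂ⁿᵒʳ, τᵗᵃⁿ⟩ = 0` for all `τ ∈ W_hᵏ⁻¹`. -/
def EqSigmaDot (σ' p : L2 Ω) (pn : (i : ι) → L2B (K i)) : Prop :=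
  ∀ τ ∈ broken Ω W ((k : ℕ) - 1),
    ipT (res K σ') (res K τ) + ipT (res K p) (dT K τ) - ipBT pn (tanT K τ) = 0

/-- `(ρ̇, η) + (p, δη) + ⟨p̂ᵗᵃⁿ, ηⁿᵒʳ⟩ = 0` for all `η ∈ W_hᵏ⁺¹`. -/
def EqRhoDot (ρ' p : L2 Ω) (pt : (i : ι) → L2B (K i)) : Prop :=
  ∀ η ∈ broken Ω W ((k : ℕ) + 1),
    ipT (res K ρ') (res K η) + ipT (res K p) (deltaT K η) + ipBT pt (norT K η) = 0

/-- The flux condition `⟨ŵᵗᵃⁿ - wᵗᵃⁿ, ĥ⟩ = 0` for all `ĥ ∈ Ŵ_h^{j,nor}`. -/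
def Flux (j : ℤ) (g : (i : ι) → L2B (K i)) (w : L2 Ω) : Prop :=
  ∀ h ∈ traceSpace W j, ipBT (g - tanT K w) h = 0

/-- The conservativity condition `⟨ŵⁿᵒʳ, ĥᵗᵃⁿ⟩ = 0` for all `ĥᵗᵃⁿ` in the single-valued trace
space with zero boundary values. -/
def Conservative (j : ℤ) (g : (i : ι) → L2B (K i)) : Prop :=
  ∀ h ∈ confTrace W j, ipBT g h = 0

/-- Time-dependent interior unknowns in the broken spaces. -/
structure InBroken (I : Set ℝ) (z : Curves Ω) : Prop where
  σ_mem : ∀ t ∈ I, z.σ t ∈ broken Ω W ((k : ℕ) - 1)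
  u_mem : ∀ t ∈ I, z.u t ∈ broken Ω W (k : ℕ)
  ρ_mem : ∀ t ∈ I, z.ρ t ∈ broken Ω W ((k : ℕ) + 1)
  p_mem : ∀ t ∈ I, z.p t ∈ broken Ω W (k : ℕ)

/-- The AFW-H method, first implementation (dynamical equations for `u, p`, constraints for `σ, ρ`),
with homogeneous Dirichlet conditions.  The components `pt`, `pn` of `y` do not occur. -/
structure IsAFWH1 (F : Potential n k) (I : Set ℝ) (z : Curves Ω) (y : TraceCurves K) : Prop where
  mem : InBroken W k I z
  σt_mem : ∀ t ∈ I, y.σt t ∈ confTrace W ((k : ℕ) - 1)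
  ut_mem : ∀ t ∈ I, y.ut t ∈ confTrace W (k : ℕ)
  un_mem : ∀ t ∈ I, y.un t ∈ traceSpace W ((k : ℕ) - 1)
  ρn_mem : ∀ t ∈ I, y.ρn t ∈ traceSpace W (k : ℕ)
  diff_u : DifferentiableOn ℝ z.u I
  diff_p : DifferentiableOn ℝ z.p I
  eq_u : ∀ t ∈ I, EqU W k (derivWithin z.u I t) (z.p t)
  eq_p : ∀ t ∈ I, EqP W k F t (z.u t) (derivWithin z.p I t) (z.σ t) (z.ρ t) (y.σt t) (y.ρn t)
  eq_tau : ∀ t ∈ I, EqTau W k (z.u t) (z.σ t) (y.un t)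
  eq_eta : ∀ t ∈ I, EqEta W k (z.u t) (z.ρ t) (y.ut t)
  flux_σ : ∀ t ∈ I, Flux W ((k : ℕ) - 1) (y.σt t) (z.σ t)
  flux_u : ∀ t ∈ I, Flux W (k : ℕ) (y.ut t) (z.u t)
  cons_u : ∀ t ∈ I, Conservative W ((k : ℕ) - 1) (y.un t)
  cons_ρ : ∀ t ∈ I, Conservative W (k : ℕ) (y.ρn t)

/-- The constraints on `σ, u, ρ` at one instant, with the flux and conservativity conditions on the
traces of `u`. -/
def HybridConstraints (σ u ρ : L2 Ω) : Prop :=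
  ∃ un ∈ traceSpace W ((k : ℕ) - 1), ∃ ut ∈ confTrace W (k : ℕ),
    EqTau W k u σ un ∧ EqEta W k u ρ ut ∧ Flux W (k : ℕ) ut u ∧ Conservative W ((k : ℕ) - 1) un

/-- The AFW-H method, second implementation (dynamical equations for `σ, u, ρ, p`, the constraints
being imposed only at the initial time `t₀`), with homogeneous Dirichlet conditions.  The components
`ut`, `un` of `y` do not occur. -/
structure IsAFWH2 (F : Potential n k) (I : Set ℝ) (t₀ : ℝ) (z : Curves Ω) (y : TraceCurves K) :
    Prop where
  mem : InBroken W k I z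
  σt_mem : ∀ t ∈ I, y.σt t ∈ confTrace W ((k : ℕ) - 1)
  pt_mem : ∀ t ∈ I, y.pt t ∈ confTrace W (k : ℕ)
  pn_mem : ∀ t ∈ I, y.pn t ∈ traceSpace W ((k : ℕ) - 1)
  ρn_mem : ∀ t ∈ I, y.ρn t ∈ traceSpace W (k : ℕ)
  diff_σ : DifferentiableOn ℝ z.σ I
  diff_u : DifferentiableOn ℝ z.u I
  diff_ρ : DifferentiableOn ℝ z.ρ I
  diff_p : DifferentiableOn ℝ z.p I
  eq_σ : ∀ t ∈ I, EqSigmaDot W k (derivWithin z.σ I t) (z.p t) (y.pn t)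
  eq_u : ∀ t ∈ I, EqU W k (derivWithin z.u I t) (z.p t)
  eq_ρ : ∀ t ∈ I, EqRhoDot W k (derivWithin z.ρ I t) (z.p t) (y.pt t)
  eq_p : ∀ t ∈ I, EqP W k F t (z.u t) (derivWithin z.p I t) (z.σ t) (z.ρ t) (y.σt t) (y.ρn t)
  flux_σ : ∀ t ∈ I, Flux W ((k : ℕ) - 1) (y.σt t) (z.σ t)
  flux_p : ∀ t ∈ I, Flux W (k : ℕ) (y.pt t) (z.p t)
  cons_p : ∀ t ∈ I, Conservative W ((k : ℕ) - 1) (y.pn t)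
  cons_ρ : ∀ t ∈ I, Conservative W (k : ℕ) (y.ρn t)
  initial : HybridConstraints W k (z.σ t₀) (z.u t₀) (z.ρ t₀)

/-- The AFW-H method with all equations: the six semidiscrete equations, all flux and conservativity
conditions, and `d/dt û = p̂`, with homogeneous Dirichlet conditions. -/
structure IsAFWH (F : Potential n k) (I : Set ℝ) (z : Curves Ω) (y : TraceCurves K) : Prop where
  mem : InBroken W k I z
  σt_mem : ∀ t ∈ I, y.σt t ∈ confTrace W ((k : ℕ) - 1)
  ut_mem : ∀ t ∈ I, y.ut t ∈ confTrace W (k : ℕ)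
  pt_mem : ∀ t ∈ I, y.pt t ∈ confTrace W (k : ℕ)
  un_mem : ∀ t ∈ I, y.un t ∈ traceSpace W ((k : ℕ) - 1)
  pn_mem : ∀ t ∈ I, y.pn t ∈ traceSpace W ((k : ℕ) - 1)
  ρn_mem : ∀ t ∈ I, y.ρn t ∈ traceSpace W (k : ℕ)
  diff_σ : DifferentiableOn ℝ z.σ I
  diff_u : DifferentiableOn ℝ z.u I
  diff_ρ : DifferentiableOn ℝ z.ρ I
  diff_p : DifferentiableOn ℝ z.p I
  deriv_ut : ∀ t ∈ I, HasDerivWithinAt y.ut (y.pt t) I t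
  deriv_un : ∀ t ∈ I, HasDerivWithinAt y.un (y.pn t) I t
  eq_σ : ∀ t ∈ I, EqSigmaDot W k (derivWithin z.σ I t) (z.p t) (y.pn t)
  eq_u : ∀ t ∈ I, EqU W k (derivWithin z.u I t) (z.p t)
  eq_ρ : ∀ t ∈ I, EqRhoDot W k (derivWithin z.ρ I t) (z.p t) (y.pt t)
  eq_tau : ∀ t ∈ I, EqTau W k (z.u t) (z.σ t) (y.un t)
  eq_p : ∀ t ∈ I, EqP W k F t (z.u t) (derivWithin z.p I t) (z.σ t) (z.ρ t) (y.σt t) (y.ρn t)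
  eq_eta : ∀ t ∈ I, EqEta W k (z.u t) (z.ρ t) (y.ut t)
  flux_σ : ∀ t ∈ I, Flux W ((k : ℕ) - 1) (y.σt t) (z.σ t)
  flux_u : ∀ t ∈ I, Flux W (k : ℕ) (y.ut t) (z.u t)
  flux_p : ∀ t ∈ I, Flux W (k : ℕ) (y.pt t) (z.p t)
  cons_u : ∀ t ∈ I, Conservative W ((k : ℕ) - 1) (y.un t)
  cons_p : ∀ t ∈ I, Conservative W ((k : ℕ) - 1) (y.pn t)
  cons_ρ : ∀ t ∈ I, Conservative W (k : ℕ) (y.ρn t)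

/-! #### The conforming method -/

/-- `σ ∈ V̊_hᵏ⁻¹` and `(u, dτ)_Ω = -(σ, τ)_Ω` for all `τ ∈ V̊_hᵏ⁻¹`. -/
def IsSigma (u σ : L2 Ω) : Prop :=
  σ ∈ conf Ω W ((k : ℕ) - 1) ∧ ∀ τ ∈ conf Ω W ((k : ℕ) - 1), ip Ω u (weakD τ) = -ip Ω σ τ

/-- `ρ ∈ V̊_hᵏ⁺¹` and `(du, η)_Ω = -(ρ, η)_Ω` for all `η ∈ V̊_hᵏ⁺¹`. -/
def IsRho (u ρ : L2 Ω) : Prop :=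
  ρ ∈ conf Ω W ((k : ℕ) + 1) ∧ ∀ η ∈ conf Ω W ((k : ℕ) + 1), ip Ω (weakD u) η = -ip Ω ρ η

/-- `(u̇, r)_Ω = (p, r)_Ω` for all `r ∈ V̊_hᵏ`. -/
def ConfEqU (u' p : L2 Ω) : Prop := ∀ r ∈ conf Ω W (k : ℕ), ip Ω u' r = ip Ω p r

/-- `-(ṗ, v)_Ω + (dσ, v)_Ω + (ρ, dv)_Ω = (f(t, u), v)_Ω` for all `v ∈ V̊_hᵏ`. -/
def ConfEqP (F : Potential n k) (t : ℝ) (u p' σ ρ : L2 Ω) : Prop :=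
  ∀ v ∈ conf Ω W (k : ℕ),
    -ip Ω p' v + ip Ω (weakD σ) v + ip Ω ρ (weakD v) = source F t u v

/-- The conforming AFW method, first formulation. -/
structure IsAFW1 (F : Potential n k) (I : Set ℝ) (z : Curves Ω) : Prop where
  u_mem : ∀ t ∈ I, z.u t ∈ conf Ω W (k : ℕ)
  p_mem : ∀ t ∈ I, z.p t ∈ conf Ω W (k : ℕ)
  diff_u : DifferentiableOn ℝ z.u I
  diff_p : DifferentiableOn ℝ z.p I
  eq_u : ∀ t ∈ I, ConfEqU W k (derivWithin z.u I t) (z.p t)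
  eq_p : ∀ t ∈ I, ConfEqP W k F t (z.u t) (derivWithin z.p I t) (z.σ t) (z.ρ t)
  eq_σ : ∀ t ∈ I, IsSigma W k (z.u t) (z.σ t)
  eq_ρ : ∀ t ∈ I, IsRho W k (z.u t) (z.ρ t)

/-- The conforming AFW method, second formulation, with the constraints imposed at time `t₀`. -/
structure IsAFW2 (F : Potential n k) (I : Set ℝ) (t₀ : ℝ) (z : Curves Ω) : Prop where
  σ_mem : ∀ t ∈ I, z.σ t ∈ conf Ω W ((k : ℕ) - 1)
  u_mem : ∀ t ∈ I, z.u t ∈ conf Ω W (k : ℕ)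
  ρ_mem : ∀ t ∈ I, z.ρ t ∈ conf Ω W ((k : ℕ) + 1)
  p_mem : ∀ t ∈ I, z.p t ∈ conf Ω W (k : ℕ)
  diff_σ : DifferentiableOn ℝ z.σ I
  diff_u : DifferentiableOn ℝ z.u I
  diff_ρ : DifferentiableOn ℝ z.ρ I
  diff_p : DifferentiableOn ℝ z.p I
  eq_σ : ∀ t ∈ I, ∀ τ ∈ conf Ω W ((k : ℕ) - 1),
    ip Ω (derivWithin z.σ I t : L2 Ω) τ + ip Ω (z.p t) (weakD τ) = 0
  eq_u : ∀ t ∈ I, ConfEqU W k (derivWithin z.u I t) (z.p t)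
  eq_ρ : ∀ t ∈ I, ∀ η ∈ conf Ω W ((k : ℕ) + 1),
    ip Ω (derivWithin z.ρ I t : L2 Ω) η + ip Ω (weakD (z.p t)) η = 0
  eq_p : ∀ t ∈ I, ConfEqP W k F t (z.u t) (derivWithin z.p I t) (z.σ t) (z.ρ t)
  initial : IsSigma W k (z.u t₀) (z.σ t₀) ∧ IsRho W k (z.u t₀) (z.ρ t₀)

/-! #### Hamilton's equations -/

/-- The solution `σ_h` of the first constraint, as a function of `u_h`. -/
noncomputable def sigmaOf (u : L2 Ω) : L2 Ω := by
  classical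
  exact if h : ∃ σ, IsSigma W k u σ then h.choose else 0

/-- The solution `ρ_h` of the second constraint, as a function of `u_h`. -/
noncomputable def rhoOf (u : L2 Ω) : L2 Ω := by
  classical
  exact if h : ∃ ρ, IsRho W k u ρ then h.choose else 0

/-- The discrete Hamiltonian
`ℋ_h(t, u, p) = ½ (‖σ_h‖² + ‖p‖² + ‖ρ_h‖²) + ∫_Ω F(t, x, u) dx`. -/
noncomputable def hamiltonian (F : Potential n k) (t : ℝ) (u p : L2 Ω) : ℝ :=
  (1 / 2 : ℝ) * (ip Ω (sigmaOf W k u) (sigmaOf W k u) + ip Ω p p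
      + ip Ω (rhoOf W k u) (rhoOf W k u))
    + ∫ x in Ω, F t x (u x k)

/-- Hamilton's equations `(J ż, w)_Ω = ∂ℋ_h/∂z · w` for all `w = (v, r)`, for a curve `z = (u, p)` in
`V̊_hᵏ ⊗ ℝ²`, where `J (u, p) = (-p, u)`. -/
structure IsHamiltonian (F : Potential n k) (I : Set ℝ) (u p : ℝ → L2 Ω) : Prop where
  u_mem : ∀ t ∈ I, u t ∈ conf Ω W (k : ℕ)
  p_mem : ∀ t ∈ I, p t ∈ conf Ω W (k : ℕ)
  diff_u : DifferentiableOn ℝ u I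
  diff_p : DifferentiableOn ℝ p I
  eq : ∀ t ∈ I, ∀ v ∈ conf Ω W (k : ℕ), ∀ r ∈ conf Ω W (k : ℕ),
    HasDerivAt (fun ε : ℝ => hamiltonian W k F t (u t + ε • v) (p t + ε • r))
      (-ip Ω (derivWithin p I t : L2 Ω) v + ip Ω (derivWithin u I t : L2 Ω) r) 0

/-- `σ` and `ρ` are recovered from `u` by solving the constraints. -/
def IsRecovered (I : Set ℝ) (z : Curves Ω) : Prop :=
  ∀ t ∈ I, z.σ t = sigmaOf W k (z.u t) ∧ z.ρ t = rhoOf W k (z.u t)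

end Methods

end HodgeWave

namespace HodgeWave

section Algebra

variable {n : ℕ}

/-! ### Exterior algebra -/

instance instFiniteDimensionalAltK (j : ℕ) : FiniteDimensional ℝ (AltK n j) := by
  let f : AltK n j →ₗ[ℝ] MultilinearMap ℝ (fun _ : Fin j => Space n) ℝ :=
    { toFun := fun a => a.toContinuousMultilinearMap.toMultilinearMap
      map_add' := fun _ _ => rfl
      map_smul' := fun _ _ => rfl }
  refine FiniteDimensional.of_injective f fun a b h => ?_
  ext v
  exact congrArg (fun g : MultilinearMap ℝ (fun _ : Fin j => Space n) ℝ => g v) h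

theorem isBilinearMap_altInner : IsBilinearMap ℝ (altInner (n := n)) where
  add_left a b c := by
    simp only [altInner, ← Finset.sum_add_distrib, ← mul_add]
    refine Finset.sum_congr rfl fun j _ => congrArg _ (Finset.sum_congr rfl fun v _ => ?_)
    simp [add_mul]
  smul_left r a b := by
    simp only [altInner, smul_eq_mul, Finset.mul_sum]
    refine Finset.sum_congr rfl fun j _ => Finset.sum_congr rfl fun v _ => ?_
    simp only [Pi.smul_apply, ContinuousAlternatingMap.smul_apply, smul_eq_mul]
    ring
  add_right a b c := by
    simp only [altInner, ← Finset.sum_add_distrib, ← mul_add]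
    refine Finset.sum_congr rfl fun j _ => congrArg _ (Finset.sum_congr rfl fun v _ => ?_)
    simp [mul_add]
  smul_right r a b := by
    simp only [altInner, smul_eq_mul, Finset.mul_sum]
    refine Finset.sum_congr rfl fun j _ => Finset.sum_congr rfl fun v _ => ?_
    simp only [Pi.smul_apply, ContinuousAlternatingMap.smul_apply, smul_eq_mul]
    ring

/-- The inner product of `Alt ℝⁿ` as a continuous bilinear form. -/
noncomputable def altInnerL : Alt n →L[ℝ] Alt n →L[ℝ] ℝ :=
  (isBilinearMap_altInner (n := n)).toContinuousBilinearMap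

theorem altInnerL_apply (a b : Alt n) : altInnerL a b = altInner a b := rfl

theorem altInner_comm (a b : Alt n) : altInner a b = altInner b a := by
  simp only [altInner, mul_comm]

theorem altInner_self_nonneg (a : Alt n) : 0 ≤ altInner a a :=
  Finset.sum_nonneg fun _ _ => mul_nonneg (by positivity)
    (Finset.sum_nonneg fun _ _ => mul_self_nonneg _)

theorem altK_ext_single {j : ℕ} {a b : AltK n j}
    (h : ∀ v : Fin j → Fin n, a (fun i => EuclideanSpace.single (v i) (1 : ℝ)) =
      b (fun i => EuclideanSpace.single (v i) (1 : ℝ))) : a = b := by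
  have h' : a.toAlternatingMap.toMultilinearMap = b.toAlternatingMap.toMultilinearMap := by
    refine Module.Basis.ext_multilinear (fun _ => (EuclideanSpace.basisFun (Fin n) ℝ).toBasis)
      fun v => ?_
    simpa using h v
  ext v
  exact congrArg (fun g : MultilinearMap ℝ (fun _ : Fin j => Space n) ℝ => g v) h'

theorem altInner_self_eq_zero {a : Alt n} (h : altInner a a = 0) : a = 0 := by
  funext j
  have h1 := (Finset.sum_eq_zero_iff_of_nonneg (fun j _ => mul_nonneg (by positivity)
    (Finset.sum_nonneg fun _ _ => mul_self_nonneg _))).1 h j (Finset.mem_univ j)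
  have h2 := (mul_eq_zero.1 h1).resolve_left
    (inv_ne_zero (Nat.cast_ne_zero.2 (Nat.factorial_ne_zero _)))
  refine altK_ext_single fun v => ?_
  have h3 := (Finset.sum_eq_zero_iff_of_nonneg fun _ _ => mul_self_nonneg _).1 h2 v
    (Finset.mem_univ v)
  simpa using h3

theorem altInnerL_injective : Function.Injective (altInnerL (n := n)) := by
  refine (injective_iff_map_eq_zero _).2 fun a ha => altInner_self_eq_zero ?_
  rw [← altInnerL_apply, ha]; rfl

theorem wedge_succ_apply (ξ : Space n) (a : Alt n) (i : Fin n) :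
    wedge ξ a i.succ = ContinuousAlternatingMap.alternatizeUncurryFin
      ((innerSL ℝ ξ).smulRight (a i.castSucc)) := rfl

theorem contract_castSucc_apply (ξ : Space n) (a : Alt n) (i : Fin n) :
    contract ξ a i.castSucc = ContinuousAlternatingMap.curryLeft (a i.succ) ξ := by
  have h : ((i.castSucc : Fin (n + 1)) : ℕ) + 1 < n + 1 := by simp
  rw [contract, dif_pos h]; rfl

theorem contract_last_apply (ξ : Space n) (a : Alt n) : contract ξ a (Fin.last n) = 0 := by
  rw [contract, dif_neg (by simp)]

theorem isBilinearMap_contract : IsBilinearMap ℝ (contract (n := n)) where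
  add_left a b c := by
    funext j
    refine Fin.lastCases ?_ (fun i => ?_) j
    · simp [contract_last_apply]
    · simp [contract_castSucc_apply]
  smul_left r a b := by
    funext j
    refine Fin.lastCases ?_ (fun i => ?_) j
    · simp [contract_last_apply]
    · simp [contract_castSucc_apply]
  add_right a b c := by
    funext j
    refine Fin.lastCases ?_ (fun i => ?_) j
    · simp [contract_last_apply]
    · simp [contract_castSucc_apply]
  smul_right r a b := by
    funext j
    refine Fin.lastCases ?_ (fun i => ?_) j
    · simp [contract_last_apply]
    · simp [contract_castSucc_apply]

/-- The contraction as a continuous bilinear map. -/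
noncomputable def contractL : Space n →L[ℝ] Alt n →L[ℝ] Alt n :=
  (isBilinearMap_contract (n := n)).toContinuousBilinearMap

theorem contractL_apply (ξ : Space n) (a : Alt n) : contractL ξ a = contract ξ a := rfl

theorem wedge_succ_apply_apply (ξ : Space n) (a : Alt n) (i : Fin n)
    (v : Fin (i + 1) → Space n) :
    wedge ξ a i.succ v = ∑ m : Fin (i + 1), (-1 : ℝ) ^ (m : ℕ) *
      (⟪ξ, v m⟫ * a i.castSucc (m.removeNth v)) := by
  rw [wedge_succ_apply]
  erw [ContinuousAlternatingMap.alternatizeUncurryFin_apply]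
  refine Finset.sum_congr rfl fun m _ => ?_
  simp [zsmul_eq_mul]

theorem isBilinearMap_wedge : IsBilinearMap ℝ (wedge (n := n)) where
  add_left a b c := by
    funext j
    refine Fin.cases ?_ (fun i => ?_) j
    · exact (add_zero (0 : AltK n 0)).symm
    · ext v
      simp only [Pi.add_apply, ContinuousAlternatingMap.add_apply]
      erw [wedge_succ_apply_apply, wedge_succ_apply_apply, wedge_succ_apply_apply]
      rw [← Finset.sum_add_distrib]
      refine Finset.sum_congr rfl fun m _ => ?_
      rw [inner_add_left]; ring
  smul_left r a b := by
    funext j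
    refine Fin.cases ?_ (fun i => ?_) j
    · exact (smul_zero (A := AltK n 0) r).symm
    · ext v
      simp only [Pi.smul_apply, ContinuousAlternatingMap.smul_apply]
      erw [wedge_succ_apply_apply, wedge_succ_apply_apply]
      rw [Finset.smul_sum]
      refine Finset.sum_congr rfl fun m _ => ?_
      rw [real_inner_smul_left, smul_eq_mul]; ring
  add_right a b c := by
    funext j
    refine Fin.cases ?_ (fun i => ?_) j
    · exact (add_zero (0 : AltK n 0)).symm
    · ext v
      simp only [Pi.add_apply, ContinuousAlternatingMap.add_apply]
      erw [wedge_succ_apply_apply, wedge_succ_apply_apply, wedge_succ_apply_apply]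
      rw [← Finset.sum_add_distrib]
      refine Finset.sum_congr rfl fun m _ => ?_
      simp only [Pi.add_apply, ContinuousAlternatingMap.add_apply]; ring
  smul_right r a b := by
    funext j
    refine Fin.cases ?_ (fun i => ?_) j
    · exact (smul_zero (A := AltK n 0) r).symm
    · ext v
      simp only [Pi.smul_apply, ContinuousAlternatingMap.smul_apply]
      erw [wedge_succ_apply_apply, wedge_succ_apply_apply]
      rw [Finset.smul_sum]
      refine Finset.sum_congr rfl fun m _ => ?_
      simp only [Pi.smul_apply, ContinuousAlternatingMap.smul_apply, smul_eq_mul]; ring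

/-- The wedge product with a covector as a continuous bilinear map. -/
noncomputable def wedgeL : Space n →L[ℝ] Alt n →L[ℝ] Alt n :=
  (isBilinearMap_wedge (n := n)).toContinuousBilinearMap

theorem wedgeL_apply (ξ : Space n) (a : Alt n) : wedgeL ξ a = wedge ξ a := rfl

/-- The contraction with `ξ` is adjoint to the wedge product with `ξ♭`, degree by degree. -/
theorem sum_wedge_mul (ξ : Space n) (a b : Alt n) (i : Fin n) :
    ∑ v : Fin (i + 1) → Fin n, wedge ξ a i.succ (fun m => EuclideanSpace.single (v m) (1 : ℝ)) *
        b i.succ (fun m => EuclideanSpace.single (v m) (1 : ℝ)) =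
      ((i : ℕ) + 1) * ∑ v : Fin i → Fin n,
        a i.castSucc (fun m => EuclideanSpace.single (v m) (1 : ℝ)) *
        contract ξ b i.castSucc (fun m => EuclideanSpace.single (v m) (1 : ℝ)) := by
  simp_rw [wedge_succ_apply_apply, Finset.sum_mul]
  rw [Finset.sum_comm]
  have key : ∀ m : Fin (i + 1), ∑ v : Fin (i + 1) → Fin n,
      (-1 : ℝ) ^ (m : ℕ) * (⟪ξ, EuclideanSpace.single (v m) (1 : ℝ)⟫ *
        a i.castSucc (m.removeNth fun l => EuclideanSpace.single (v l) (1 : ℝ))) *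
        b i.succ (fun l => EuclideanSpace.single (v l) (1 : ℝ)) =
      ∑ v : Fin i → Fin n,
        a i.castSucc (fun m => EuclideanSpace.single (v m) (1 : ℝ)) *
        contract ξ b i.castSucc (fun m => EuclideanSpace.single (v m) (1 : ℝ)) := by
    intro m
    rw [← (Fin.insertNthEquiv (fun _ : Fin (i + 1) => Fin n) m).sum_comp, Fintype.sum_prod_type,
      Finset.sum_comm]
    refine Finset.sum_congr rfl fun w _ => ?_
    have hξ : ξ = ∑ l : Fin n, ξ l • EuclideanSpace.single l (1 : ℝ) := by
      conv_lhs => rw [← (EuclideanSpace.basisFun (Fin n) ℝ).sum_repr ξ]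
      simp
    have h1 : contract ξ b i.castSucc (fun m => EuclideanSpace.single (w m) (1 : ℝ)) =
        ∑ l : Fin n, ξ l * b i.succ (Fin.cons (EuclideanSpace.single l (1 : ℝ))
          (fun m => EuclideanSpace.single (w m) (1 : ℝ)) : Fin (i + 1) → Space n) := by
      rw [contract_castSucc_apply]
      conv_lhs => rw [hξ]
      rw [map_sum, ContinuousAlternatingMap.sum_apply]
      refine Finset.sum_congr rfl fun l _ => ?_
      rw [map_smul, ContinuousAlternatingMap.smul_apply, smul_eq_mul]
      rfl
    rw [h1, Finset.mul_sum]
    refine Finset.sum_congr rfl fun l _ => ?_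
    have h2 : (fun l' => EuclideanSpace.single
        ((Fin.insertNthEquiv (fun _ : Fin (i + 1) => Fin n) m) (l, w) l') (1 : ℝ)) =
        m.insertNth (EuclideanSpace.single l (1 : ℝ))
          (fun m => EuclideanSpace.single (w m) (1 : ℝ)) := by
      refine Fin.eq_insertNth_iff.2 ⟨by simp, ?_⟩
      funext q
      simp [Fin.removeNth]
    have h3 : b i.succ (fun l' => EuclideanSpace.single
        ((Fin.insertNthEquiv (fun _ : Fin (i + 1) => Fin n) m) (l, w) l') (1 : ℝ)) = _ :=
      (congrArg _ h2).trans <| ContinuousAlternatingMap.map_insertNth (b i.succ) m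
      (EuclideanSpace.single l (1 : ℝ)) (fun m => EuclideanSpace.single (w m) (1 : ℝ))
    rw [h2, Fin.removeNth_insertNth]
    erw [h3]
    have h4 : ((-1 : ℝ) ^ (m : ℕ)) * (-1 : ℝ) ^ (m : ℕ) = 1 := by
      rw [← mul_pow]; norm_num
    simp only [Fin.insertNthEquiv, Equiv.coe_fn_mk, Fin.insertNth_apply_same,
      EuclideanSpace.inner_single_right, one_mul, zsmul_eq_mul]
    push_cast
    have h5 : ∀ s x y z : ℝ, s * s = 1 → s * (x * y) * (s * z) = y * (x * z) := by
      intro s x y z hs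
      linear_combination (x * y * z) * hs
    exact h5 _ _ _ _ h4
  refine (Finset.sum_congr rfl fun m _ => key m).trans ?_
  simp

theorem altInner_wedge (ξ : Space n) (a b : Alt n) :
    altInner (wedge ξ a) b = altInner a (contract ξ b) := by
  rw [altInner, Fin.sum_univ_succ, altInner, Fin.sum_univ_castSucc]
  have h0 : ∀ v : Fin ((0 : Fin (n + 1)) : ℕ) → Space n, wedge ξ a 0 v = 0 := fun _ => rfl
  have h1 : ∀ v : Fin (Fin.last n : ℕ) → Space n, contract ξ b (Fin.last n) v = 0 := fun v => by
    rw [contract_last_apply]; rfl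
  simp only [h0, h1, zero_mul, mul_zero, Finset.sum_const_zero, zero_add, add_zero]
  refine Finset.sum_congr rfl fun i _ => ?_
  have := sum_wedge_mul ξ a b i
  erw [this]
  simp only [Fin.val_succ, Fin.val_castSucc, Nat.factorial_succ]
  push_cast
  have h1 : ((i : ℕ) + 1 : ℝ) ≠ 0 := by positivity
  have h2 : (((i : ℕ).factorial : ℕ) : ℝ) ≠ 0 := Nat.cast_ne_zero.2 (Nat.factorial_ne_zero _)
  field_simp

theorem contract_contract_swap (ξ η : Space n) (a : Alt n) :
    contract ξ (contract η a) = -contract η (contract ξ a) := by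
  rw [eq_neg_iff_add_eq_zero]
  have hs : ∀ ζ : Space n, contract ζ (contract ζ a) = 0 := by
    intro ζ
    funext j
    by_cases h : (j : ℕ) + 1 < n + 1
    · have h1 : contract ζ (contract ζ a) j =
          ContinuousAlternatingMap.curryLeft (contract ζ a ⟨(j : ℕ) + 1, h⟩) ζ := dif_pos h
      rw [h1]
      by_cases h' : (j : ℕ) + 1 + 1 < n + 1
      · have h2 : contract ζ a ⟨(j : ℕ) + 1, h⟩ =
            ContinuousAlternatingMap.curryLeft (a ⟨(j : ℕ) + 1 + 1, h'⟩) ζ := dif_pos h'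
        exact (congrArg (fun f : AltK n ((j : ℕ) + 1) =>
          ContinuousAlternatingMap.curryLeft f ζ) h2).trans
            (ContinuousAlternatingMap.curryLeft_same _ _)
      · have h2 : contract ζ a ⟨(j : ℕ) + 1, h⟩ = 0 := dif_neg h'
        rw [h2]
        simp
    · exact dif_neg h
  have h := hs (ξ + η)
  simp only [← contractL_apply, map_add, add_apply] at h hs ⊢
  rw [hs, hs] at h
  simpa [add_comm] using h

end Algebra

section Geometry

variable {n : ℕ}

/-! ### Geometry of Lipschitz boundaries -/

theorem frontier_eq_empty_of_dim_zero (hn : n = 0) (K : Set (Space n)) : frontier K = ∅ := by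
  subst hn
  rcases Set.eq_empty_or_nonempty K with h | h
  · simp [h]
  · simp [Set.Nonempty.eq_univ h]

/-- Near a boundary point the boundary lies on the Lipschitz graph. -/
theorem mem_graph_of_mem_frontier {K U : Set (Space n)} {e : Space n} {γ : Space n → ℝ}
    (hK : IsOpen K) (hU : IsOpen U) (hγ : Continuous γ)
    (h : ∀ y ∈ U, (y ∈ K ↔ ⟪y, e⟫ < γ (y - ⟪y, e⟫ • e))) {y : Space n} (hy : y ∈ frontier K)
    (hyU : y ∈ U) : ⟪y, e⟫ = γ (y - ⟪y, e⟫ • e) := by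
  have hc : Continuous fun y : Space n => γ (y - ⟪y, e⟫ • e) := by fun_prop
  rw [hK.frontier_eq] at hy
  rcases lt_trichotomy ⟪y, e⟫ (γ (y - ⟪y, e⟫ • e)) with hlt | heq | hgt
  · exact absurd ((h y hyU).2 hlt) hy.2
  · exact heq
  · exfalso
    have ho : IsOpen (U ∩ {y : Space n | γ (y - ⟪y, e⟫ • e) < ⟪y, e⟫}) :=
      hU.inter (isOpen_lt hc (by fun_prop))
    obtain ⟨w, ⟨hwU, hw⟩, hwK⟩ := mem_closure_iff.1 hy.1 _ ho ⟨hyU, hgt⟩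
    exact lt_asymm hw ((h w hwU).1 hwK)

theorem hausdorffMeasure_frontier_lt_top {K : Set (Space n)} (hK : IsLipschitzOpen K)
    (hb : Bornology.IsBounded K) : (μHE[n - 1] : Measure (Space n)) (frontier K) < ⊤ := by
  have hc : IsCompact (frontier K) :=
    hb.isCompact_closure.of_isClosed_subset isClosed_frontier frontier_subset_closure
  refine hc.measure_lt_top_of_nhdsWithin fun x hx => ?_
  obtain ⟨e, he, U, γ, C, hU, hγ, h⟩ := hK.2 x hx
  obtain ⟨r, hr, hrU⟩ := Metric.mem_nhds_iff.1 hU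
  refine ⟨frontier K ∩ Metric.ball x r,
    inter_mem_nhdsWithin _ (Metric.ball_mem_nhds x hr), ?_⟩
  have hn : n ≠ 0 := by
    rintro rfl
    rw [Subsingleton.elim e 0, norm_zero] at he
    exact zero_ne_one he
  have he0 : e ≠ 0 := by
    rintro rfl
    simp at he
  let E := (Submodule.span ℝ {e})ᗮ
  have hfin : Module.finrank ℝ E = n - 1 := by
    have : Fact (Module.finrank ℝ (Space n) = (n - 1) + 1) := ⟨by simp; omega⟩
    exact Submodule.finrank_orthogonal_span_singleton he0
  let G : E → Space n := fun z => (z : Space n) + γ z • e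
  have hG : LipschitzWith (1 + C) G := by
    refine LipschitzWith.of_dist_le_mul fun z w => ?_
    have h1 : dist (γ z) (γ w) ≤ C * dist z w := hγ.dist_le_mul z w
    calc dist (G z) (G w) ≤ dist (z : Space n) w + dist (γ z • e) (γ w • e) := dist_add_add_le _ _ _ _
      _ ≤ dist z w + C * dist z w := by
          refine add_le_add le_rfl ?_
          rw [dist_eq_norm, ← sub_smul, norm_smul, he, mul_one, ← dist_eq_norm]
          exact h1
      _ = ((1 + C : NNReal) : ℝ) * dist z w := by push_cast; ring
  have hsub : frontier K ∩ Metric.ball x r ⊆ G '' Metric.closedBall 0 (‖x‖ + r) := by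
    rintro y ⟨hy, hyr⟩
    have hgr := mem_graph_of_mem_frontier hK.1 Metric.isOpen_ball hγ.continuous
      (fun y hy => h y (hrU hy)) hy hyr
    have hz : y - ⟪y, e⟫ • e ∈ E := by
      rw [Submodule.mem_orthogonal_singleton_iff_inner_left]
      rw [inner_sub_left, real_inner_smul_left, real_inner_self_eq_norm_sq, he]
      ring
    refine ⟨⟨_, hz⟩, ?_, ?_⟩
    · rw [mem_closedBall_zero_iff]
      change ‖y - ⟪y, e⟫ • e‖ ≤ _
      have h1 : ‖y - ⟪y, e⟫ • e‖ ^ 2 ≤ ‖y‖ ^ 2 := by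
        rw [norm_sub_sq_real, norm_smul, he, inner_smul_right, mul_one, Real.norm_eq_abs, sq_abs]
        nlinarith [sq_nonneg ⟪y, e⟫]
      have h2 : ‖y‖ ≤ ‖x‖ + r := by
        have := norm_le_norm_add_norm_sub' y x
        have h3 : ‖y - x‖ < r := by simpa [dist_eq_norm] using hyr
        linarith
      exact (abs_le_of_sq_le_sq' h1 (norm_nonneg _)).2.trans h2
    · change y - ⟪y, e⟫ • e + γ (y - ⟪y, e⟫ • e) • e = y
      rw [← hgr, sub_add_cancel]
  refine (measure_mono hsub).trans_lt ?_
  rw [Measure.euclideanHausdorffMeasure_def, Measure.smul_apply]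
  have h3 : (μH[(n - 1 : ℕ)] : Measure (Space n)) (G '' Metric.closedBall 0 (‖x‖ + r)) < ⊤ := by
    refine (hG.hausdorffMeasure_image_le (Nat.cast_nonneg _) _).trans_lt ?_
    refine ENNReal.mul_lt_top (ENNReal.rpow_lt_top_of_nonneg (Nat.cast_nonneg _) (by simp)) ?_
    rw [← hfin]
    exact (isCompact_closedBall _ _).measure_lt_top
  exact ENNReal.mul_lt_top ENNReal.coe_lt_top h3

theorem isFiniteMeasure_surf {K : Set (Space n)} (hK : IsLipschitzOpen K)
    (hb : Bornology.IsBounded K) : IsFiniteMeasure (surf K) :=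
  ⟨by rw [surf, Measure.restrict_apply_univ]; exact hausdorffMeasure_frontier_lt_top hK hb⟩

theorem volume_frontier_eq_zero {K : Set (Space n)} (hK : IsLipschitzOpen K)
    (hb : Bornology.IsBounded K) : (volume : Measure (Space n)) (frontier K) = 0 := by
  rcases Nat.eq_zero_or_pos n with hn | hn
  · rw [frontier_eq_empty_of_dim_zero hn, measure_empty]
  · rw [← EuclideanSpace.euclideanHausdorffMeasure_eq_volume]
    exact (Measure.euclideanHausdorffMeasure_zero_or_top (Nat.sub_lt hn one_pos) _).resolve_right
      (hausdorffMeasure_frontier_lt_top hK hb).ne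

theorem IsOuterNormal.unique {K : Set (Space n)} {x ν ν' : Space n} (h : IsOuterNormal K x ν)
    (h' : IsOuterNormal K x ν') : ν = ν' := by
  by_contra hne
  have hd : 0 < ‖ν' - ν‖ := norm_pos_iff.2 (sub_ne_zero.2 (Ne.symm hne))
  have hsq : ‖ν' - ν‖ ^ 2 = 2 - 2 * ⟪ν', ν⟫ := by
    rw [norm_sub_sq_real, h.1, h'.1]; ring
  have h1 : ⟪ν' - ν, ν⟫ = -(‖ν' - ν‖ ^ 2 / 2) := by
    rw [hsq, inner_sub_left, real_inner_self_eq_norm_sq, h.1]; ring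
  have h2 : ⟪ν' - ν, ν'⟫ = ‖ν' - ν‖ ^ 2 / 2 := by
    rw [hsq, inner_sub_left, real_inner_self_eq_norm_sq, h'.1, real_inner_comm]; ring
  have hε : 0 < ‖ν' - ν‖ / 4 := by positivity
  have ht : Tendsto (fun s : ℝ => x + s • (ν' - ν)) (𝓝[>] 0) (𝓝 x) := by
    have : Tendsto (fun s : ℝ => x + s • (ν' - ν)) (𝓝 0) (𝓝 (x + (0 : ℝ) • (ν' - ν))) :=
      (Continuous.tendsto (by fun_prop) 0)
    rw [zero_smul, add_zero] at this
    exact this.mono_left nhdsWithin_le_nhds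
  obtain ⟨s, ⟨ha, hb⟩, hs⟩ := (((ht.eventually ((h.2 _ hε).and (h'.2 _ hε))).and
    self_mem_nhdsWithin).exists)
  have hs : 0 < s := hs
  have hsd : x + s • (ν' - ν) - x = s • (ν' - ν) := by abel
  rw [hsd, norm_smul, Real.norm_of_nonneg hs.le, real_inner_smul_left] at ha hb
  rw [h1] at ha
  rw [h2] at hb
  have hp : 0 < s * ‖ν' - ν‖ ^ 2 := by positivity
  exact hb.2 (by nlinarith) (ha.1 (by nlinarith))

theorem measurableSet_isOuterNormal (K : Set (Space n)) :
    MeasurableSet {q : Space n × Space n | IsOuterNormal K q.1 q.2} := by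
  let A : ℕ → ℕ → Set (Space n × Space n) := fun m l => {q | ∀ y : Space n,
    (‖y - q.1‖ < 1 / ((l : ℝ) + 1) ∧ ⟪y - q.1, q.2⟫ < -(1 / ((m : ℝ) + 1) * ‖y - q.1‖) → y ∈ K) ∧
    (‖y - q.1‖ < 1 / ((l : ℝ) + 1) ∧ 1 / ((m : ℝ) + 1) * ‖y - q.1‖ < ⟪y - q.1, q.2⟫ → y ∉ K)}
  have hA : ∀ m l, IsClosed (A m l) := by
    intro m l
    have h1 : ∀ y : Space n, IsOpen {q : Space n × Space n | ‖y - q.1‖ < 1 / ((l : ℝ) + 1)} :=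
      fun y => isOpen_lt (by fun_prop) (by fun_prop)
    have h2 : ∀ y : Space n, IsOpen {q : Space n × Space n |
        ⟪y - q.1, q.2⟫ < -(1 / ((m : ℝ) + 1) * ‖y - q.1‖)} :=
      fun y => isOpen_lt (by fun_prop) (by fun_prop)
    have h3 : ∀ y : Space n, IsOpen {q : Space n × Space n |
        1 / ((m : ℝ) + 1) * ‖y - q.1‖ < ⟪y - q.1, q.2⟫} :=
      fun y => isOpen_lt (by fun_prop) (by fun_prop)
    simp only [A, ofPred_forall, ofPred_and]
    exact isClosed_iInter fun y => (isClosed_imp ((h1 y).inter (h2 y)) isClosed_const).inter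
      (isClosed_imp ((h1 y).inter (h3 y)) isClosed_const)
  have heq : {q : Space n × Space n | IsOuterNormal K q.1 q.2} =
      {q | ‖q.2‖ = 1} ∩ ⋂ m, ⋃ l, A m l := by
    ext ⟨x, ν⟩
    simp only [mem_ofPred_eq, mem_inter_iff, mem_iInter, mem_iUnion, IsOuterNormal, A]
    refine and_congr Iff.rfl ⟨fun h m => ?_, fun h ε hε => ?_⟩
    · obtain ⟨δ, hδ, hb⟩ := Metric.eventually_nhds_iff.1 (h (1 / ((m : ℝ) + 1)) (by positivity))
      obtain ⟨l, hl⟩ := exists_nat_one_div_lt hδ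
      refine ⟨l, fun y => ⟨fun hy => ?_, fun hy => ?_⟩⟩
      · exact (hb (by rw [dist_eq_norm]; exact hy.1.trans hl)).1 hy.2
      · exact (hb (by rw [dist_eq_norm]; exact hy.1.trans hl)).2 hy.2
    · obtain ⟨m, hm⟩ := exists_nat_one_div_lt hε
      obtain ⟨l, hl⟩ := h m
      refine Metric.eventually_nhds_iff.2 ⟨1 / ((l : ℝ) + 1), by positivity, fun y hy => ?_⟩
      rw [dist_eq_norm] at hy
      have hmul := mul_le_mul_of_nonneg_right hm.le (norm_nonneg (y - x))
      exact ⟨fun h1 => (hl y).1 ⟨hy, h1.trans_le (neg_le_neg hmul)⟩,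
        fun h1 => (hl y).2 ⟨hy, hmul.trans_lt h1⟩⟩
  rw [heq]
  exact (isClosed_eq (by fun_prop) continuous_const).measurableSet.inter
    (MeasurableSet.iInter fun m => MeasurableSet.iUnion fun l => (hA m l).measurableSet)

theorem isOuterNormal_outerNormal {K : Set (Space n)} {x : Space n}
    (h : ∃ ν, IsOuterNormal K x ν) : IsOuterNormal K x (outerNormal K x) := by
  rw [outerNormal, dif_pos h]
  exact h.choose_spec

theorem measurable_outerNormal (K : Set (Space n)) : Measurable (outerNormal K) := by
  intro B hB
  let G := {q : Space n × Space n | IsOuterNormal K q.1 q.2}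
  have hG : MeasurableSet G := measurableSet_isOuterNormal K
  have hinj : InjOn Prod.fst G := by
    rintro ⟨x, ν⟩ h ⟨x', ν'⟩ h' (rfl : x = x')
    rw [IsOuterNormal.unique (show IsOuterNormal K x ν from h) h']
  have hN : MeasurableSet (Prod.fst '' G) := hG.image_of_measurable_injOn measurable_fst hinj
  have hGB : MeasurableSet (Prod.fst '' (G ∩ Prod.snd ⁻¹' B)) :=
    (hG.inter (measurable_snd hB)).image_of_measurable_injOn measurable_fst
      (hinj.mono inter_subset_left)
  have heq : outerNormal K ⁻¹' B =
      Prod.fst '' (G ∩ Prod.snd ⁻¹' B) ∪ ((Prod.fst '' G)ᶜ ∩ {_x | (0 : Space n) ∈ B}) := by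
    ext x
    by_cases h : ∃ ν, IsOuterNormal K x ν
    · have h1 := isOuterNormal_outerNormal h
      constructor
      · intro hx
        exact Or.inl ⟨(x, outerNormal K x), ⟨h1, hx⟩, rfl⟩
      · rintro (⟨⟨x', ν⟩, ⟨hν, hB'⟩, rfl⟩ | ⟨hx, -⟩)
        · have := h1.unique hν
          rw [mem_preimage, this]
          exact hB'
        · exact absurd ⟨(x, outerNormal K x), h1, rfl⟩ hx
    · have h0 : outerNormal K x = 0 := by rw [outerNormal, dif_neg h]
      have hx : x ∉ Prod.fst '' G := by
        rintro ⟨⟨x', ν⟩, hν, rfl⟩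
        exact h ⟨ν, hν⟩
      rw [mem_preimage, h0]
      constructor
      · exact fun hB' => Or.inr ⟨hx, hB'⟩
      · rintro (⟨q, hq, rfl⟩ | ⟨-, hB'⟩)
        · exact absurd ⟨q, hq.1, rfl⟩ hx
        · exact hB'
  rw [heq]
  exact hGB.union (hN.compl.inter (MeasurableSet.const _))

theorem norm_outerNormal_le (K : Set (Space n)) (x : Space n) : ‖outerNormal K x‖ ≤ 1 := by
  by_cases h : ∃ ν, IsOuterNormal K x ν
  · exact (isOuterNormal_outerNormal h).1.le
  · rw [outerNormal, dif_neg h, norm_zero]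
    exact zero_le_one

end Geometry

section PartialSum

variable {n : ℕ} {F : Type*} [NormedAddCommGroup F] [NormedSpace ℝ F]
  (C : Space n →L[ℝ] F →L[ℝ] F)

/-! ### First order operators -/

/-- The operator `φ ↦ -∑ᵢ C(eᵢ) ∂ᵢ φ`. -/
noncomputable def partialSum (φ : Space n → F) (x : Space n) : F :=
  -∑ i : Fin n, C (EuclideanSpace.single i (1 : ℝ))
    (fderiv ℝ φ x (EuclideanSpace.single i (1 : ℝ)))

theorem contDiff_partialSum {φ : Space n → F} (hφ : ContDiff ℝ ∞ φ) :
    ContDiff ℝ ∞ (partialSum C φ) :=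
  (ContDiff.sum fun _ _ => (C _).contDiff.comp
    ((hφ.fderiv_right (by simp)).clm_apply contDiff_const)).neg

theorem tsupport_partialSum_subset (φ : Space n → F) :
    tsupport (partialSum C φ) ⊆ tsupport φ := by
  refine (closure_mono fun x hx => ?_).trans (tsupport_fderiv_subset ℝ)
  contrapose! hx
  rw [Function.notMem_support] at hx ⊢
  simp [partialSum, hx]

theorem partialSum_partialSum (hC : ∀ v w a, C v (C w a) = -C w (C v a)) {φ : Space n → F}
    (hφ : ContDiff ℝ ∞ φ) : partialSum C (partialSum C φ) = 0 := by
  funext x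
  have hd : Differentiable ℝ (fderiv ℝ φ) :=
    (hφ.fderiv_right (m := ∞) (by simp)).differentiable (by simp)
  have hsymm : ∀ v w : Space n, fderiv ℝ (fderiv ℝ φ) x v w = fderiv ℝ (fderiv ℝ φ) x w v :=
    second_derivative_symmetric
      (fun y => (hφ.differentiable (by simp) y).hasFDerivAt) (hd x).hasFDerivAt
  have h1 : ∀ v, fderiv ℝ (partialSum C φ) x v = -∑ j : Fin n,
      C (EuclideanSpace.single j (1 : ℝ))
        (fderiv ℝ (fderiv ℝ φ) x v (EuclideanSpace.single j (1 : ℝ))) := by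
    intro v
    have h := (HasFDerivAt.fun_sum (u := Finset.univ) fun (j : Fin n) _ =>
      (C (EuclideanSpace.single j (1 : ℝ))).hasFDerivAt.comp x
        ((hd x).hasFDerivAt.clm_apply
          (hasFDerivAt_const (EuclideanSpace.single j (1 : ℝ)) x))).neg
    have h' : HasFDerivAt (partialSum C φ) _ x := h
    rw [h'.fderiv]
    simp
  have h2 : partialSum C (partialSum C φ) x =
      ∑ i : Fin n, ∑ j : Fin n, C (EuclideanSpace.single i (1 : ℝ))
        (C (EuclideanSpace.single j (1 : ℝ)) (fderiv ℝ (fderiv ℝ φ) x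
          (EuclideanSpace.single i (1 : ℝ)) (EuclideanSpace.single j (1 : ℝ)))) := by
    rw [partialSum, ← Finset.sum_neg_distrib]
    refine Finset.sum_congr rfl fun i _ => ?_
    rw [h1]
    simp only [map_neg, map_sum, neg_neg]
  have h3 : partialSum C (partialSum C φ) x = -partialSum C (partialSum C φ) x := by
    conv_lhs => rw [h2, Finset.sum_comm]
    rw [h2, ← Finset.sum_neg_distrib]
    refine Finset.sum_congr rfl fun i _ => ?_
    rw [← Finset.sum_neg_distrib]
    refine Finset.sum_congr rfl fun j _ => ?_
    rw [hC, hsymm]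
  have h4 : (2 : ℝ) • partialSum C (partialSum C φ) x = 0 := by
    rw [two_smul]
    nth_rewrite 1 [h3]
    exact neg_add_cancel _
  exact (smul_eq_zero.1 h4).resolve_left two_ne_zero

end PartialSum

section Pairing

variable {n : ℕ} {μ : Measure (Space n)}

/-! ### The `L²` pairing of forms -/

theorem integrable_altInner {f g : Space n → Alt n} (hf : MemLp f 2 μ) (hg : MemLp g 2 μ) :
    Integrable (fun x => altInner (f x) (g x)) μ :=
  memLp_one_iff_integrable.1 (altInnerL.memLp_of_bilin 1 hf hg)

/-- The `L²` pairing as a bilinear form. -/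
noncomputable def pairL (μ : Measure (Space n)) :
    Lp (Alt n) 2 μ →ₗ[ℝ] Lp (Alt n) 2 μ →ₗ[ℝ] ℝ :=
  LinearMap.mk₂ ℝ (fun f g => ∫ x, altInner (f x) (g x) ∂μ)
    (fun f f' g => by
      rw [← integral_add (integrable_altInner (Lp.memLp f) (Lp.memLp g))
        (integrable_altInner (Lp.memLp f') (Lp.memLp g))]
      refine integral_congr_ae ?_
      filter_upwards [Lp.coeFn_add f f'] with x hx
      rw [hx, Pi.add_apply, isBilinearMap_altInner.add_left])
    (fun r f g => by
      rw [smul_eq_mul, ← integral_const_mul]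
      refine integral_congr_ae ?_
      filter_upwards [Lp.coeFn_smul r f] with x hx
      rw [hx, Pi.smul_apply, isBilinearMap_altInner.smul_left, smul_eq_mul])
    (fun f g g' => by
      rw [← integral_add (integrable_altInner (Lp.memLp f) (Lp.memLp g))
        (integrable_altInner (Lp.memLp f) (Lp.memLp g'))]
      refine integral_congr_ae ?_
      filter_upwards [Lp.coeFn_add g g'] with x hx
      rw [hx, Pi.add_apply, isBilinearMap_altInner.add_right])
    (fun r f g => by
      rw [smul_eq_mul, ← integral_const_mul]
      refine integral_congr_ae ?_
      filter_upwards [Lp.coeFn_smul r g] with x hx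
      rw [hx, Pi.smul_apply, isBilinearMap_altInner.smul_right, smul_eq_mul])

theorem pairL_apply (f g : Lp (Alt n) 2 μ) : pairL μ f g = ∫ x, altInner (f x) (g x) ∂μ := rfl

theorem pairL_toLp (f : Lp (Alt n) 2 μ) {g : Space n → Alt n} (hg : MemLp g 2 μ) :
    pairL μ f (hg.toLp g) = ∫ x, altInner (f x) (g x) ∂μ := by
  refine integral_congr_ae ?_
  filter_upwards [hg.coeFn_toLp] with x hx
  rw [hx]

theorem pairL_comm (f g : Lp (Alt n) 2 μ) : pairL μ f g = pairL μ g f := by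
  simp only [pairL_apply, altInner_comm]

theorem pairL_self_nonneg (f : Lp (Alt n) 2 μ) : 0 ≤ pairL μ f f :=
  integral_nonneg fun _ => altInner_self_nonneg _

theorem pairL_self_eq_zero {f : Lp (Alt n) 2 μ} (h : pairL μ f f = 0) : f = 0 := by
  have h1 := (integral_eq_zero_iff_of_nonneg (fun x => altInner_self_nonneg (f x))
    (integrable_altInner (Lp.memLp f) (Lp.memLp f))).1 h
  refine Lp.ext ?_
  filter_upwards [h1, Lp.coeFn_zero (Alt n) 2 μ] with x hx hx0
  rw [hx0]
  exact altInner_self_eq_zero hx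

/-! ### Test forms -/

theorem IsTestForm.memLp [IsFiniteMeasureOnCompacts μ] {φ : Space n → Alt n} (hφ : IsTestForm φ) :
    MemLp φ 2 μ :=
  hφ.1.continuous.memLp_of_hasCompactSupport hφ.2

theorem ae_eq_zero_of_forall_testForm {U : Set (Space n)} (hU : IsOpen U) {f : Space n → Alt n}
    (hf : LocallyIntegrableOn f U μ)
    (h : ∀ φ : Space n → Alt n, IsTestForm φ → tsupport φ ⊆ U →
      ∫ x, altInner (f x) (φ x) ∂μ = 0) : ∀ᵐ x ∂μ, x ∈ U → f x = 0 := by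
  have hc : ∀ c : Alt n, ∀ᵐ x ∂μ, x ∈ U → altInner (f x) c = 0 := by
    intro c
    have hloc : LocallyIntegrableOn (fun x => altInner (f x) c) U μ := by
      intro x hx
      obtain ⟨s, hs, hfs⟩ := hf x hx
      refine ⟨s, hs, ?_⟩
      simp only [altInner_comm _ c]
      exact (altInnerL c).integrable_comp hfs
    refine hU.ae_eq_zero_of_integral_contDiff_smul_eq_zero hloc fun g hg hgc hgU => ?_
    have hφ : IsTestForm fun x => g x • c := ⟨hg.smul contDiff_const, hgc.smul_right⟩
    rw [← h _ hφ ((closure_mono (Function.support_smul_subset_left g _)).trans hgU)]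
    simp only [isBilinearMap_altInner.smul_right]
  let b := Module.finBasis ℝ (Alt n)
  filter_upwards [ae_all_iff.2 fun i => hc (b i)] with x hx hxU
  refine altInnerL_injective ((ContinuousLinearMap.coe_injective (b.ext fun i => ?_)).trans
    (map_zero altInnerL).symm)
  exact hx i hxU

/-! ### The codifferential of test forms -/

theorem IsTestForm.deltaSmooth {φ : Space n → Alt n} (hφ : IsTestForm φ) :
    IsTestForm (deltaSmooth φ) :=
  ⟨contDiff_partialSum contractL hφ.1,
    hφ.2.of_isClosed_subset (isClosed_tsupport _) (tsupport_partialSum_subset contractL φ)⟩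

theorem tsupport_deltaSmooth_subset (φ : Space n → Alt n) :
    tsupport (deltaSmooth φ) ⊆ tsupport φ :=
  tsupport_partialSum_subset contractL φ

theorem IsTestForm.deltaSmooth_deltaSmooth {φ : Space n → Alt n} (hφ : IsTestForm φ) :
    HodgeWave.deltaSmooth (HodgeWave.deltaSmooth φ) = 0 :=
  partialSum_partialSum contractL contract_contract_swap hφ.1

end Pairing

section Weak

variable {n : ℕ} {U : Set (Space n)}

/-! ### Weak differentials -/

theorem ip_eq_pairL (w v : L2 U) : ip U w v = pairL _ w v := rfl

theorem ip_testForm (w : L2 U) {φ : Space n → Alt n} (hφ : IsTestForm φ) :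
    ip U w φ = pairL _ w (hφ.memLp.toLp φ) :=
  (pairL_toLp w hφ.memLp).symm

theorem ip_add_testForm (w v : L2 U) {φ : Space n → Alt n} (hφ : IsTestForm φ) :
    ip U (w + v : L2 U) φ = ip U w φ + ip U v φ := by
  simp only [ip_testForm _ hφ, map_add, LinearMap.add_apply]

theorem ip_smul_testForm (r : ℝ) (w : L2 U) {φ : Space n → Alt n} (hφ : IsTestForm φ) :
    ip U (r • w : L2 U) φ = r * ip U w φ := by
  simp only [ip_testForm _ hφ, map_smul, LinearMap.smul_apply, smul_eq_mul]

theorem ip_zero_testForm {φ : Space n → Alt n} (hφ : IsTestForm φ) :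
    ip U (0 : L2 U) φ = 0 := by
  simp only [ip_testForm _ hφ, map_zero, LinearMap.zero_apply]

theorem eq_of_forall_testForm (hU : IsOpen U) {w v : L2 U}
    (h : ∀ φ : Space n → Alt n, IsTestForm φ → tsupport φ ⊆ U → ip U w φ = ip U v φ) : w = v := by
  rw [← sub_eq_zero]
  have h0 := ae_eq_zero_of_forall_testForm (μ := volume.restrict U) hU
    (f := ((w - v : L2 U) : Space n → Alt n))
    (((Lp.memLp (w - v)).locallyIntegrable (by norm_num)).locallyIntegrableOn U)
    fun φ hφ hs => by
      change ip U (w - v : L2 U) φ = 0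
      rw [ip_testForm _ hφ, map_sub, LinearMap.sub_apply, ← ip_testForm _ hφ, ← ip_testForm _ hφ,
        h φ hφ hs, sub_self]
  refine Lp.ext ?_
  filter_upwards [h0, ae_restrict_mem hU.measurableSet, Lp.coeFn_zero (Alt n) 2 (volume.restrict U)]
    with x hx hxU hx0
  rw [hx0, hx hxU]
  rfl

theorem HasWeakD.unique (hU : IsOpen U) {w η η' : L2 U} (h : HasWeakD w η) (h' : HasWeakD w η') :
    η = η' :=
  eq_of_forall_testForm hU fun φ hφ hs => (h φ hφ hs).symm.trans (h' φ hφ hs)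

theorem HasWeakD.add {w η w' η' : L2 U} (h : HasWeakD w η) (h' : HasWeakD w' η') :
    HasWeakD (w + w') (η + η') := fun φ hφ hs => by
  rw [ip_add_testForm _ _ hφ.deltaSmooth, ip_add_testForm _ _ hφ, h φ hφ hs, h' φ hφ hs]

theorem HasWeakD.smul (r : ℝ) {w η : L2 U} (h : HasWeakD w η) :
    HasWeakD (r • w) (r • η) := fun φ hφ hs => by
  rw [ip_smul_testForm _ _ hφ.deltaSmooth, ip_smul_testForm _ _ hφ, h φ hφ hs]

theorem InH.hasWeakD {w : L2 U} (h : InH w) : HasWeakD w (weakD w) := by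
  rw [weakD, dif_pos h]
  exact h.choose_spec

theorem HasWeakD.weakD_eq (hU : IsOpen U) {w η : L2 U} (h : HasWeakD w η) : weakD w = η :=
  (InH.hasWeakD ⟨η, h⟩).unique hU h

theorem HasWeakD.weakD {w η : L2 U} (h : HasWeakD w η) : HasWeakD η 0 := fun φ hφ hs => by
  rw [← h _ hφ.deltaSmooth ((tsupport_deltaSmooth_subset φ).trans hs),
    hφ.deltaSmooth_deltaSmooth, ip_zero_testForm hφ]
  simp only [ip, Pi.zero_apply, ← altInnerL_apply, map_zero, integral_zero]

theorem weakD_weakD (hU : IsOpen U) {w : L2 U} (h : InH w) : weakD (weakD w) = 0 :=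
  h.hasWeakD.weakD.weakD_eq hU

theorem weakD_add (hU : IsOpen U) {w v : L2 U} (hw : InH w) (hv : InH v) :
    weakD (w + v) = weakD w + weakD v :=
  (hw.hasWeakD.add hv.hasWeakD).weakD_eq hU

theorem weakD_smul (hU : IsOpen U) (r : ℝ) {w : L2 U} (hw : InH w) :
    weakD (r • w) = r • weakD w :=
  (hw.hasWeakD.smul r).weakD_eq hU

end Weak

section Trace

variable {n : ℕ} {K : Set (Space n)}

/-! ### Traces -/

theorem aestronglyMeasurable_outerNormal {μ : Measure (Space n)} :
    AEStronglyMeasurable (outerNormal K) μ :=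
  (measurable_outerNormal K).aestronglyMeasurable

theorem memLp_outerNormal_bilin {μ : Measure (Space n)} (B : Space n →L[ℝ] Alt n →L[ℝ] Alt n)
    {g : Space n → Alt n} (hg : MemLp g 2 μ) : MemLp (fun x => B (outerNormal K x) (g x)) 2 μ :=
  B.memLp_of_bilin 2 (memLp_top_of_bound aestronglyMeasurable_outerNormal 1
    (Eventually.of_forall (norm_outerNormal_le K))) hg

/-- The density `ν ∧ g` of the tangential jump. -/
noncomputable def normalWedge (g : L2B K) : Space n → Alt n :=
  fun x => wedge (outerNormal K x) (g x)

theorem memLp_normalWedge (g : L2B K) : MemLp (normalWedge g) 2 (surf K) :=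
  memLp_outerNormal_bilin wedgeL (Lp.memLp g)

theorem ipB_contract (g : L2B K) (φ : Space n → Alt n) :
    ipB K g (fun x => contract (outerNormal K x) (φ x)) =
      ∫ x, altInner (normalWedge g x) (φ x) ∂(surf K) := by
  simp only [ipB, normalWedge, altInner_wedge]

theorem IsTangential.add {g h : L2B K} (hg : IsTangential g) (hh : IsTangential h) :
    IsTangential (g + h) := by
  filter_upwards [hg, hh, Lp.coeFn_add g h] with x hx hx' ha
  rw [ha, Pi.add_apply]
  conv_lhs => rw [hx, hx']
  simp only [← contractL_apply, ← wedgeL_apply, map_add]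

theorem IsTangential.smul (r : ℝ) {g : L2B K} (hg : IsTangential g) : IsTangential (r • g) := by
  filter_upwards [hg, Lp.coeFn_smul r g] with x hx ha
  rw [ha, Pi.smul_apply]
  conv_lhs => rw [hx]
  simp only [← contractL_apply, ← wedgeL_apply, map_smul]

theorem IsTangential.eq_zero {g : L2B K} (hg : IsTangential g)
    (h : ∀ᵐ x ∂(surf K), normalWedge g x = 0) : g = 0 := by
  refine Lp.ext ?_
  filter_upwards [hg, h, Lp.coeFn_zero (Alt n) 2 (surf K)] with x hx hx' hx0
  rw [hx0, hx]
  change contract _ (normalWedge g x) = 0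
  rw [hx', ← contractL_apply, map_zero]

theorem hasTanTrace_tanTrace {w : L2 K} (h : ∃ g, HasTanTrace w g) :
    HasTanTrace w (tanTrace w) := by
  rw [tanTrace, dif_pos h]
  exact h.choose_spec

theorem hasNorTrace_norTrace {w : L2 K} (h : ∃ g, HasNorTrace w g) :
    HasNorTrace w (norTrace w) := by
  rw [norTrace, dif_pos h]
  exact h.choose_spec

variable [IsFiniteMeasure (surf K)]

theorem memLp_contract {φ : Space n → Alt n} (hφ : IsTestForm φ) :
    MemLp (fun x => contract (outerNormal K x) (φ x)) 2 (surf K) :=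
  memLp_outerNormal_bilin contractL hφ.memLp

theorem ipB_eq_pairL (g : L2B K) {φ : Space n → Alt n} (hφ : IsTestForm φ) :
    ipB K g (fun x => contract (outerNormal K x) (φ x)) =
      pairL (surf K) g ((memLp_contract hφ).toLp _) :=
  (pairL_toLp g _).symm

theorem IsTangential.eq_zero_of_forall {g : L2B K} (hg : IsTangential g)
    (h : ∀ φ : Space n → Alt n, IsTestForm φ →
      ipB K g (fun x => contract (outerNormal K x) (φ x)) = 0) : g = 0 := by
  refine hg.eq_zero ?_
  have := ae_eq_zero_of_forall_testForm (μ := surf K) isOpen_univ (f := normalWedge g)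
    ((((memLp_normalWedge g).locallyIntegrable (by norm_num))).locallyIntegrableOn _)
    fun φ hφ _ => by rw [← ipB_contract, h φ hφ]
  filter_upwards [this] with x hx using hx trivial

theorem HasTanTrace.add (hK : IsOpen K) {w w' : L2 K} {g g' : L2B K} (h : HasTanTrace w g)
    (h' : HasTanTrace w' g') : HasTanTrace (w + w') (g + g') := by
  refine ⟨⟨_, h.1.hasWeakD.add h'.1.hasWeakD⟩, h.2.1.add h'.2.1, fun φ hφ => ?_⟩
  rw [weakD_add hK h.1 h'.1, ip_add_testForm _ _ hφ, ip_add_testForm _ _ hφ.deltaSmooth,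
    ipB_eq_pairL _ hφ, map_add, LinearMap.add_apply, ← ipB_eq_pairL _ hφ, ← ipB_eq_pairL _ hφ,
    h.2.2 φ hφ, h'.2.2 φ hφ]
  ring

theorem HasTanTrace.smul (hK : IsOpen K) (r : ℝ) {w : L2 K} {g : L2B K} (h : HasTanTrace w g) :
    HasTanTrace (r • w) (r • g) := by
  refine ⟨⟨_, h.1.hasWeakD.smul r⟩, h.2.1.smul r, fun φ hφ => ?_⟩
  rw [weakD_smul hK r h.1, ip_smul_testForm _ _ hφ, ip_smul_testForm _ _ hφ.deltaSmooth,
    ipB_eq_pairL _ hφ, map_smul, LinearMap.smul_apply, ← ipB_eq_pairL _ hφ,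
    h.2.2 φ hφ, smul_eq_mul]
  ring

theorem HasTanTrace.unique {w : L2 K} {g g' : L2B K} (h : HasTanTrace w g)
    (h' : HasTanTrace w g') : g = g' := by
  rw [← sub_eq_zero]
  have ht : IsTangential (g - g') := by
    have := h.2.1.add (h'.2.1.smul (-1))
    rwa [neg_one_smul, ← sub_eq_add_neg] at this
  refine ht.eq_zero_of_forall fun φ hφ => ?_
  rw [ipB_eq_pairL _ hφ, map_sub, LinearMap.sub_apply, ← ipB_eq_pairL _ hφ, ← ipB_eq_pairL _ hφ,
    h.2.2 φ hφ, h'.2.2 φ hφ, sub_self]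

theorem HasTanTrace.tanTrace_eq {w : L2 K} {g : L2B K} (h : HasTanTrace w g) : tanTrace w = g :=
  (hasTanTrace_tanTrace ⟨g, h⟩).unique h

end Trace

section Indicator

variable {X F ι : Type*} [MeasurableSpace X] [NormedAddCommGroup F] {μ : Measure X}

theorem memLp_indicator_of_restrict {p : ENNReal} {s : Set X} (hs : MeasurableSet s) {f : X → F}
    (hf : MemLp f p (μ.restrict s)) : MemLp (s.indicator f) p μ :=
  (memLp_indicator_iff_restrict hs).2 hf

theorem memLp_sum_fintype [Fintype ι] {p : ENNReal} {f : ι → X → F} (hf : ∀ i, MemLp (f i) p μ) :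
    MemLp (fun x => ∑ i, f i x) p μ := memLp_finsetSum _ fun i _ => hf i

end Indicator

section Restriction

variable {n : ℕ} {U V : Set (Space n)}

/-! ### Restriction and gluing -/

theorem restr_ae (h : V ⊆ U) (w : L2 U) : restr V w =ᵐ[volume.restrict V] w := by
  rw [restr, dif_pos h]
  exact MemLp.coeFn_toLp _

theorem restr_add (h : V ⊆ U) (w v : L2 U) : restr V (w + v) = restr V w + restr V v := by
  refine Lp.ext ?_
  filter_upwards [restr_ae h (w + v), restr_ae h w, restr_ae h v,
    Lp.coeFn_add (restr V w) (restr V v),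
    ae_mono (Measure.restrict_mono h le_rfl) (Lp.coeFn_add w v)] with x h1 h2 h3 h4 h5
  rw [h1, h4, h5, Pi.add_apply, Pi.add_apply, h2, h3]

theorem restr_smul (h : V ⊆ U) (r : ℝ) (w : L2 U) : restr V (r • w) = r • restr V w := by
  refine Lp.ext ?_
  filter_upwards [restr_ae h (r • w), restr_ae h w, Lp.coeFn_smul r (restr V w),
    ae_mono (Measure.restrict_mono h le_rfl) (Lp.coeFn_smul r w)] with x h1 h2 h4 h5
  rw [h1, h4, h5, Pi.smul_apply, Pi.smul_apply, h2]

theorem ip_restr (h : V ⊆ U) (w : L2 U) (v : Space n → Alt n) :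
    ip V (restr V w) v = ∫ x in V, altInner (w x) (v x) := by
  refine integral_congr_ae ?_
  filter_upwards [restr_ae h w] with x hx
  rw [hx]

theorem ip_restr_restr (h : V ⊆ U) (w v : L2 U) :
    ip V (restr V w) (restr V v) = ∫ x in V, altInner (w x) (v x) := by
  rw [ip_restr h]
  refine integral_congr_ae ?_
  filter_upwards [restr_ae h v] with x hx
  rw [hx]

end Restriction

section Mesh

variable {n : ℕ} {ι : Type*} {Ω : Set (Space n)} {K : ι → Set (Space n)}

theorem hasTanTrace_tanT {W : (i : ι) → ℤ → Submodule ℝ (L2 (K i))} (hW : IsLocalComplex K W)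
    {j : ℤ} {w : L2 Ω} (hw : w ∈ broken Ω W j) (i : ι) :
    HasTanTrace (restr (K i) w) (tanT K w i) :=
  hasTanTrace_tanTrace (hW.tan_mem i j _ (hw i))

namespace IsMesh

theorem isOpen_elem (hK : IsMesh Ω K) (i : ι) : IsOpen (K i) := (hK.lipschitz_elem i).1

theorem bounded_elem (hK : IsMesh Ω K) (i : ι) : Bornology.IsBounded (K i) :=
  hK.bounded.subset (hK.subset i)

theorem res_add (hK : IsMesh Ω K) (w v : L2 Ω) : res K (w + v) = res K w + res K v :=
  funext fun i => restr_add (hK.subset i) w v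

theorem res_smul (hK : IsMesh Ω K) (r : ℝ) (w : L2 Ω) : res K (r • w) = r • res K w :=
  funext fun i => restr_smul (hK.subset i) r w

theorem isFiniteMeasure_surf (hK : IsMesh Ω K) (i : ι) : IsFiniteMeasure (surf (K i)) :=
  HodgeWave.isFiniteMeasure_surf (hK.lipschitz_elem i) (hK.bounded_elem i)

theorem res_zero (hK : IsMesh Ω K) : res K (0 : L2 Ω) = 0 := by
  have := hK.res_smul 0 (0 : L2 Ω)
  rwa [zero_smul, zero_smul] at this

variable [Fintype ι]

theorem iUnion_ae_eq (hK : IsMesh Ω K) : (⋃ i, K i) =ᵐ[volume] Ω := by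
  refine (LE.le.eventuallyLE (iUnion_subset hK.subset)).antisymm ?_
  have h0 : ∀ᵐ x ∂(volume : Measure (Space n)), ∀ i, x ∉ frontier (K i) :=
    ae_all_iff.2 fun i => measure_eq_zero_iff_ae_notMem.1
      (volume_frontier_eq_zero (hK.lipschitz_elem i) (hK.bounded_elem i))
  filter_upwards [h0] with x hx hxΩ
  obtain ⟨i, hi⟩ := mem_iUnion.1 (hK.cover hxΩ)
  refine mem_iUnion.2 ⟨i, ?_⟩
  by_contra hxi
  exact hx i ((hK.isOpen_elem i).frontier_eq ▸ ⟨hi, hxi⟩)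

theorem setIntegral_eq_sum (hK : IsMesh Ω K) {f : Space n → ℝ} (hf : IntegrableOn f Ω) :
    ∫ x in Ω, f x = ∑ i, ∫ x in K i, f x := by
  rw [← setIntegral_congr_set hK.iUnion_ae_eq]
  exact integral_iUnion_fintype (fun i => (hK.isOpen_elem i).measurableSet) hK.disjoint
    fun i => hf.mono_set (hK.subset i)

theorem ip_eq_ipT (hK : IsMesh Ω K) (w v : L2 Ω) : ip Ω w v = ipT (res K w) (res K v) := by
  rw [ip, hK.setIntegral_eq_sum (integrable_altInner (Lp.memLp w) (Lp.memLp v))]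
  exact Finset.sum_congr rfl fun i _ => (ip_restr_restr (hK.subset i) w v).symm

theorem ip_testForm_eq_sum (hK : IsMesh Ω K) (w : L2 Ω) {φ : Space n → Alt n}
    (hφ : IsTestForm φ) : ip Ω w φ = ∑ i, ip (K i) (restr (K i) w) φ := by
  rw [ip, hK.setIntegral_eq_sum (integrable_altInner (Lp.memLp w) hφ.memLp)]
  exact Finset.sum_congr rfl fun i _ => (ip_restr (hK.subset i) w φ).symm

theorem res_injective (hK : IsMesh Ω K) : Function.Injective (res (Ω := Ω) K) := by
  intro w v h
  rw [← sub_eq_zero]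
  refine pairL_self_eq_zero ?_
  have h0 : res K (w - v) = 0 := by
    rw [sub_eq_add_neg, ← neg_one_smul ℝ v, hK.res_add, hK.res_smul, h, neg_one_smul,
      add_neg_cancel]
  rw [← ip_eq_pairL, hK.ip_eq_ipT, h0]
  refine Finset.sum_eq_zero fun i _ => ?_
  rw [ip_eq_pairL, Pi.zero_apply, map_zero]

theorem exists_glue (hK : IsMesh Ω K) (η : (i : ι) → L2 (K i)) : ∃ w : L2 Ω, res K w = η := by
  have hm : ∀ i, MemLp ((K i).indicator (η i)) 2 ((volume : Measure (Space n)).restrict Ω) := by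
    intro i
    refine memLp_indicator_of_restrict (F := Alt n) (hK.isOpen_elem i).measurableSet ?_
    rw [Measure.restrict_restrict_of_subset (hK.subset i)]
    exact Lp.memLp (η i)
  have hs : MemLp (fun x => ∑ i, (K i).indicator (η i) x) 2
      ((volume : Measure (Space n)).restrict Ω) := memLp_sum_fintype (F := Alt n) hm
  refine ⟨hs.toLp _, funext fun i => Lp.ext ?_⟩
  filter_upwards [restr_ae (hK.subset i) (hs.toLp _),
    ae_mono (Measure.restrict_mono (hK.subset i) le_rfl) hs.coeFn_toLp,
    ae_restrict_mem (hK.isOpen_elem i).measurableSet] with x h1 h2 h3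
  rw [res, h1, h2, Finset.sum_eq_single i, indicator_of_mem h3]
  · intro j _ hj
    exact indicator_of_notMem (fun hx => (hK.disjoint hj).le_bot ⟨hx, h3⟩) _
  · simp

end IsMesh

variable {W : (i : ι) → ℤ → Submodule ℝ (L2 (K i))}

/-! ### The broken and the conforming spaces -/

theorem tanT_add (hK : IsMesh Ω K) (hW : IsLocalComplex K W) {j : ℤ} {w v : L2 Ω}
    (hw : w ∈ broken Ω W j) (hv : v ∈ broken Ω W j) :
    tanT K (w + v) = tanT K w + tanT K v := by
  funext i
  have := hK.isFiniteMeasure_surf i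
  rw [tanT, restr_add (hK.subset i)]
  exact ((hasTanTrace_tanT hW hw i).add (hK.isOpen_elem i) (hasTanTrace_tanT hW hv i)).tanTrace_eq

theorem tanT_smul (hK : IsMesh Ω K) (hW : IsLocalComplex K W) {j : ℤ} (r : ℝ) {w : L2 Ω}
    (hw : w ∈ broken Ω W j) : tanT K (r • w) = r • tanT K w := by
  funext i
  have := hK.isFiniteMeasure_surf i
  rw [tanT, restr_smul (hK.subset i)]
  exact ((hasTanTrace_tanT hW hw i).smul (hK.isOpen_elem i) r).tanTrace_eq

/-- The broken space as a subspace. -/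
noncomputable def brokenSub (hK : IsMesh Ω K) (W : (i : ι) → ℤ → Submodule ℝ (L2 (K i))) (j : ℤ) :
    Submodule ℝ (L2 Ω) where
  carrier := broken Ω W j
  add_mem' hw hv i := by
    rw [restr_add (hK.subset i)]
    exact (W i j).add_mem (hw i) (hv i)
  zero_mem' i := by
    rw [show restr (K i) (0 : L2 Ω) = 0 from congrFun hK.res_zero i]
    exact (W i j).zero_mem
  smul_mem' r w hw i := by
    rw [restr_smul (hK.subset i)]
    exact (W i j).smul_mem r (hw i)

variable [Fintype ι]

/-- The broken differential as a form on the whole domain. -/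
noncomputable def brokenD (K : ι → Set (Space n)) (w : L2 Ω) : L2 Ω := by
  classical
  exact if h : ∃ η : L2 Ω, res K η = dT K w then h.choose else 0

theorem IsMesh.res_brokenD (hK : IsMesh Ω K) (w : L2 Ω) : res K (brokenD K w) = dT K w := by
  have h := hK.exists_glue (dT K w)
  rw [brokenD, dif_pos h]
  exact h.choose_spec

theorem IsMesh.restr_brokenD (hK : IsMesh Ω K) (w : L2 Ω) (i : ι) :
    restr (K i) (brokenD K w) = weakD (restr (K i) w) := congrFun (hK.res_brokenD w) i

theorem IsMesh.ipT_res_dT (hK : IsMesh Ω K) (u w : L2 Ω) :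
    ipT (res K u) (dT K w) = ip Ω u (brokenD K w) := by
  rw [hK.ip_eq_ipT, hK.res_brokenD]

theorem IsMesh.noJump_iff (hK : IsMesh Ω K) (g : (i : ι) → L2B (K i)) :
    NoJump g ↔ ∀ φ : Space n → Alt n, IsTestForm φ →
      ∑ i, ipB (K i) (g i) (fun x => contract (outerNormal (K i) x) (φ x)) = 0 := by
  let μ : Measure (Space n) := (μHE[n - 1] : Measure (Space n)).restrict (⋃ i, frontier (K i))
  let J : Space n → Alt n := fun x => ∑ i, (frontier (K i)).indicator (normalWedge (g i)) x
  have hmeas : ∀ i, MeasurableSet (frontier (K i)) := fun i => isClosed_frontier.measurableSet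
  have hres : ∀ i, μ.restrict (frontier (K i)) = surf (K i) := fun i =>
    Measure.restrict_restrict_of_subset (subset_iUnion (fun i => frontier (K i)) i)
  have hfin : IsFiniteMeasure μ := ⟨by
    rw [Measure.restrict_apply_univ]
    refine (measure_iUnion_le _).trans_lt ?_
    rw [tsum_fintype]
    exact ENNReal.sum_lt_top.2 fun i _ =>
      hausdorffMeasure_frontier_lt_top (hK.lipschitz_elem i) (hK.bounded_elem i)⟩
  have hm : ∀ i, MemLp ((frontier (K i)).indicator (normalWedge (g i))) 2 μ := fun i => by
    refine memLp_indicator_of_restrict (F := Alt n) (hmeas i) ?_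
    rw [hres]
    exact memLp_normalWedge (g i)
  have hJ : MemLp J 2 μ := memLp_sum_fintype (F := Alt n) hm
  have hkey : ∀ φ : Space n → Alt n, IsTestForm φ →
      ∑ i, ipB (K i) (g i) (fun x => contract (outerNormal (K i) x) (φ x)) =
        ∫ x, altInner (J x) (φ x) ∂μ := by
    intro φ hφ
    have h1 : ∀ x, altInner (J x) (φ x) =
        ∑ i, altInner ((frontier (K i)).indicator (normalWedge (g i)) x) (φ x) := by
      intro x
      simp only [altInner_comm _ (φ x), ← altInnerL_apply, J, map_sum]
    simp only [h1]
    rw [integral_finsetSum _ fun i _ => integrable_altInner (hm i) hφ.memLp]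
    refine Finset.sum_congr rfl fun i _ => ?_
    rw [ipB_contract, ← hres, ← integral_indicator (hmeas i)]
    congr 1
    funext x
    by_cases hx : x ∈ frontier (K i)
    · rw [indicator_of_mem hx, indicator_of_mem hx]
    · rw [indicator_of_notMem hx, indicator_of_notMem hx, altInner_comm, ← altInnerL_apply,
        map_zero]
  have hNJ : NoJump g ↔ ∀ᵐ x ∂μ, J x = 0 := Iff.rfl
  rw [hNJ]
  constructor
  · intro h φ hφ
    rw [hkey φ hφ]
    refine integral_eq_zero_of_ae ?_
    filter_upwards [h] with x hx
    rw [hx, altInner_comm, ← altInnerL_apply, map_zero]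
    rfl
  · intro h
    have := ae_eq_zero_of_forall_testForm (μ := μ) isOpen_univ (f := J)
      ((hJ.locallyIntegrable (by norm_num)).locallyIntegrableOn _)
      fun φ hφ _ => by rw [← hkey φ hφ, h φ hφ]
    filter_upwards [this] with x hx using hx trivial

theorem brokenD_mem (hK : IsMesh Ω K) (hW : IsLocalComplex K W) {j : ℤ} {w : L2 Ω}
    (hw : w ∈ broken Ω W j) : brokenD K w ∈ broken Ω W (j + 1) := fun i => by
  rw [hK.restr_brokenD]
  exact hW.subcomplex i j _ (hw i)

theorem brokenD_add (hK : IsMesh Ω K) (hW : IsLocalComplex K W) {j : ℤ} {w v : L2 Ω}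
    (hw : w ∈ broken Ω W j) (hv : v ∈ broken Ω W j) :
    brokenD K (w + v) = brokenD K w + brokenD K v := by
  refine hK.res_injective ?_
  rw [hK.res_add]
  simp only [hK.res_brokenD]
  funext i
  simp only [dT, Pi.add_apply]
  rw [restr_add (hK.subset i),
    weakD_add (hK.isOpen_elem i) (hW.inH i j _ (hw i)) (hW.inH i j _ (hv i))]

theorem brokenD_smul (hK : IsMesh Ω K) (hW : IsLocalComplex K W) {j : ℤ} (r : ℝ) {w : L2 Ω}
    (hw : w ∈ broken Ω W j) : brokenD K (r • w) = r • brokenD K w := by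
  refine hK.res_injective ?_
  rw [hK.res_smul]
  simp only [hK.res_brokenD]
  funext i
  simp only [dT, Pi.smul_apply]
  rw [restr_smul (hK.subset i), weakD_smul (hK.isOpen_elem i) r (hW.inH i j _ (hw i))]

theorem brokenD_brokenD (hK : IsMesh Ω K) (hW : IsLocalComplex K W) {j : ℤ} {w : L2 Ω}
    (hw : w ∈ broken Ω W j) : brokenD K (brokenD K w) = 0 := by
  refine hK.res_injective ?_
  rw [hK.res_brokenD, hK.res_zero]
  funext i
  simp only [dT]
  rw [hK.restr_brokenD, weakD_weakD (hK.isOpen_elem i) (hW.inH i j _ (hw i))]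
  rfl

/-- Elementwise integration by parts. -/
theorem ipBT_tanT_norT (hK : IsMesh Ω K) (hW : IsLocalComplex K W) {j l : ℤ} {w v : L2 Ω}
    (hw : w ∈ broken Ω W j) (hv : v ∈ broken Ω W l) :
    ipBT (tanT K w) (norT K v) = ip Ω (brokenD K w) v - ipT (res K w) (deltaT K v) := by
  rw [hK.ip_eq_ipT, hK.res_brokenD]
  simp only [ipBT, ipT]
  rw [← Finset.sum_sub_distrib]
  exact Finset.sum_congr rfl fun i _ =>
    (hasNorTrace_norTrace (hW.nor_mem i l _ (hv i))).2.2 _ _ (hasTanTrace_tanT hW hw i)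

/-- A broken form is conforming iff its broken differential is its distributional differential on
the whole space after extension by zero. -/
theorem mem_conf_iff (hK : IsMesh Ω K) (hW : IsLocalComplex K W) {j : ℤ} {w : L2 Ω} :
    w ∈ conf Ω W j ↔ w ∈ broken Ω W j ∧ ∀ φ : Space n → Alt n, IsTestForm φ →
      ip Ω w (deltaSmooth φ) = ip Ω (brokenD K w) φ := by
  refine and_congr_right fun hw => ?_
  rw [hK.noJump_iff]
  refine forall₂_congr fun φ hφ => ?_
  rw [hK.ip_testForm_eq_sum _ hφ, hK.ip_testForm_eq_sum _ hφ.deltaSmooth,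
    Finset.sum_congr rfl fun i _ => (hasTanTrace_tanT hW hw i).2.2 φ hφ, Finset.sum_sub_distrib,
    sub_eq_zero, eq_comm]
  simp only [hK.restr_brokenD]

theorem hasWeakD_brokenD (hK : IsMesh Ω K) (hW : IsLocalComplex K W) {j : ℤ} {w : L2 Ω}
    (hw : w ∈ conf Ω W j) : HasWeakD w (brokenD K w) :=
  fun φ hφ _ => ((mem_conf_iff hK hW).1 hw).2 φ hφ

theorem weakD_eq_brokenD (hK : IsMesh Ω K) (hW : IsLocalComplex K W) {j : ℤ} {w : L2 Ω}
    (hw : w ∈ conf Ω W j) : weakD w = brokenD K w :=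
  (hasWeakD_brokenD hK hW hw).weakD_eq hK.lipschitz.1

theorem brokenD_mem_conf (hK : IsMesh Ω K) (hW : IsLocalComplex K W) {j : ℤ} {w : L2 Ω}
    (hw : w ∈ conf Ω W j) : brokenD K w ∈ conf Ω W (j + 1) := by
  refine (mem_conf_iff hK hW).2 ⟨brokenD_mem hK hW hw.1, fun φ hφ => ?_⟩
  rw [← ((mem_conf_iff hK hW).1 hw).2 _ hφ.deltaSmooth, hφ.deltaSmooth_deltaSmooth,
    brokenD_brokenD hK hW hw.1, ip_zero_testForm hφ]
  simp only [ip, Pi.zero_apply, ← altInnerL_apply, map_zero, integral_zero]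

theorem finiteDimensional_brokenSub (hK : IsMesh Ω K) (hW : IsLocalComplex K W) (j : ℤ) :
    FiniteDimensional ℝ (brokenSub hK W j) := by
  have := hW.finite
  let f : brokenSub hK W j →ₗ[ℝ] (i : ι) → W i j :=
    { toFun := fun w i => ⟨restr (K i) (w : L2 Ω), w.2 i⟩
      map_add' := fun w v => funext fun i => Subtype.ext (restr_add (hK.subset i) _ _)
      map_smul' := fun r w => funext fun i => Subtype.ext (restr_smul (hK.subset i) r _) }
  refine FiniteDimensional.of_injective f fun w v h => Subtype.ext (hK.res_injective ?_)
  funext i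
  exact congrArg Subtype.val (congrFun h i)

/-- The conforming space as a subspace. -/
noncomputable def confSub (hK : IsMesh Ω K) (hW : IsLocalComplex K W) (j : ℤ) :
    Submodule ℝ (L2 Ω) where
  carrier := conf Ω W j
  add_mem' {w v} hw hv := by
    obtain ⟨hw1, hw2⟩ := (mem_conf_iff hK hW).1 hw
    obtain ⟨hv1, hv2⟩ := (mem_conf_iff hK hW).1 hv
    refine (mem_conf_iff hK hW).2 ⟨(brokenSub hK W j).add_mem hw1 hv1, fun φ hφ => ?_⟩
    rw [brokenD_add hK hW hw1 hv1, ip_add_testForm _ _ hφ, ip_add_testForm _ _ hφ.deltaSmooth,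
      hw2 φ hφ, hv2 φ hφ]
  zero_mem' := by
    have h0 := (brokenSub hK W j).zero_mem
    refine (mem_conf_iff hK hW).2 ⟨h0, fun φ hφ => ?_⟩
    have := brokenD_smul hK hW 0 h0
    rw [zero_smul, zero_smul] at this
    rw [this, ip_zero_testForm hφ, ip_zero_testForm hφ.deltaSmooth]
  smul_mem' r w hw := by
    obtain ⟨hw1, hw2⟩ := (mem_conf_iff hK hW).1 hw
    refine (mem_conf_iff hK hW).2 ⟨(brokenSub hK W j).smul_mem r hw1, fun φ hφ => ?_⟩
    rw [brokenD_smul hK hW r hw1, ip_smul_testForm _ _ hφ, ip_smul_testForm _ _ hφ.deltaSmooth,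
      hw2 φ hφ]

theorem confSub_le (hK : IsMesh Ω K) (hW : IsLocalComplex K W) (j : ℤ) :
    confSub hK hW j ≤ brokenSub hK W j := fun _ hw => hw.1

theorem finiteDimensional_confSub (hK : IsMesh Ω K) (hW : IsLocalComplex K W) (j : ℤ) :
    FiniteDimensional ℝ (confSub hK hW j) :=
  have := finiteDimensional_brokenSub hK hW j
  Submodule.finiteDimensional_of_le (confSub_le hK hW j)

/-- The broken differential as a linear map. -/
noncomputable def brokenDL (hK : IsMesh Ω K) (hW : IsLocalComplex K W) (j : ℤ) :
    brokenSub hK W j →ₗ[ℝ] L2 Ω where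
  toFun w := brokenD K (w : L2 Ω)
  map_add' w v := brokenD_add hK hW w.2 v.2
  map_smul' r w := brokenD_smul hK hW r w.2

/-- The tangential trace as a linear map. -/
noncomputable def tanTL (hK : IsMesh Ω K) (hW : IsLocalComplex K W) (j : ℤ) :
    brokenSub hK W j →ₗ[ℝ] ((i : ι) → L2B (K i)) where
  toFun w := tanT K (w : L2 Ω)
  map_add' w v := tanT_add hK hW w.2 v.2
  map_smul' r w := tanT_smul hK hW r w.2

theorem mem_traceSpace_iff (hK : IsMesh Ω K) {j : ℤ} {g : (i : ι) → L2B (K i)} :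
    g ∈ traceSpace W j ↔ ∃ w ∈ broken Ω W j, tanT K w = g := by
  constructor
  · intro h
    choose v hv hg using h
    obtain ⟨w, hw⟩ := hK.exists_glue v
    have hw' : ∀ i, restr (K i) w = v i := fun i => congrFun hw i
    refine ⟨w, fun i => by rw [hw' i]; exact hv i, funext fun i => ?_⟩
    rw [tanT, hw' i, hg i]
  · rintro ⟨w, hw, rfl⟩ i
    exact ⟨_, hw i, rfl⟩

theorem mem_confTrace_iff (hK : IsMesh Ω K) {j : ℤ} {g : (i : ι) → L2B (K i)} :
    g ∈ confTrace W j ↔ ∃ w ∈ conf Ω W j, tanT K w = g := by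
  constructor
  · rintro ⟨h, hJ⟩
    obtain ⟨w, hw, rfl⟩ := (mem_traceSpace_iff hK).1 h
    exact ⟨w, ⟨hw, hJ⟩, rfl⟩
  · rintro ⟨w, hw, rfl⟩
    exact ⟨(mem_traceSpace_iff hK).2 ⟨w, hw.1, rfl⟩, hw.2⟩

/-- The trace space as a subspace. -/
noncomputable def traceSub (hK : IsMesh Ω K) (hW : IsLocalComplex K W) (j : ℤ) :
    Submodule ℝ ((i : ι) → L2B (K i)) := LinearMap.range (tanTL hK hW j)

theorem mem_traceSub (hK : IsMesh Ω K) (hW : IsLocalComplex K W) {j : ℤ}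
    {g : (i : ι) → L2B (K i)} : g ∈ traceSub hK hW j ↔ g ∈ traceSpace W j := by
  rw [mem_traceSpace_iff hK]
  constructor
  · rintro ⟨w, rfl⟩
    exact ⟨w, w.2, rfl⟩
  · rintro ⟨w, hw, rfl⟩
    exact ⟨⟨w, hw⟩, rfl⟩

/-- The pairing on the skeleton as a bilinear form. -/
noncomputable def ipBTL (K : ι → Set (Space n)) :
    ((i : ι) → L2B (K i)) →ₗ[ℝ] ((i : ι) → L2B (K i)) →ₗ[ℝ] ℝ :=
  ∑ i, (pairL (surf (K i))).compl₁₂ (LinearMap.proj i) (LinearMap.proj i)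

theorem ipBTL_apply (g h : (i : ι) → L2B (K i)) : ipBTL K g h = ipBT g h := by
  simp only [ipBTL, LinearMap.sum_apply, LinearMap.compl₁₂_apply, LinearMap.proj_apply]
  rfl

theorem ipBTL_self_eq_zero {g : (i : ι) → L2B (K i)} (h : ipBTL K g g = 0) : g = 0 := by
  simp only [ipBTL, LinearMap.sum_apply, LinearMap.compl₁₂_apply, LinearMap.proj_apply] at h
  funext i
  exact pairL_self_eq_zero
    ((Finset.sum_eq_zero_iff_of_nonneg fun i _ => pairL_self_nonneg (g i)).1 h i (Finset.mem_univ i))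

/-- The flux condition determines the trace. -/
theorem Flux.eq (hK : IsMesh Ω K) (hW : IsLocalComplex K W) {j : ℤ} {g : (i : ι) → L2B (K i)}
    {w : L2 Ω} (hg : g ∈ traceSpace W j) (hw : w ∈ broken Ω W j) (h : Flux W j g w) :
    g = tanT K w := by
  rw [← sub_eq_zero]
  refine ipBTL_self_eq_zero ?_
  rw [ipBTL_apply]
  refine h _ ((mem_traceSub hK hW).1 ((traceSub hK hW j).sub_mem ((mem_traceSub hK hW).2 hg) ?_))
  exact ⟨⟨w, hw⟩, rfl⟩

theorem flux_tanT {j : ℤ} (w : L2 Ω) : Flux W j (tanT K w) w := fun h _ => by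
  rw [sub_self, ← ipBTL_apply, map_zero, LinearMap.zero_apply]

/-- The flux condition with a single-valued trace forces conformity. -/
theorem Flux.mem_conf (hK : IsMesh Ω K) (hW : IsLocalComplex K W) {j : ℤ}
    {g : (i : ι) → L2B (K i)} {w : L2 Ω} (hg : g ∈ confTrace W j) (hw : w ∈ broken Ω W j)
    (h : Flux W j g w) : w ∈ conf Ω W j :=
  ⟨hw, h.eq hK hW hg.1 hw ▸ hg.2⟩

end Mesh

section LinearAlgebra

/-! ### Linear algebra -/

theorem exists_riesz {V : Type*} [AddCommGroup V] [Module ℝ V] [FiniteDimensional ℝ V]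
    (B : V →ₗ[ℝ] V →ₗ[ℝ] ℝ) (hB : ∀ v, B v v = 0 → v = 0) :
    ∃ R : (V →ₗ[ℝ] ℝ) →ₗ[ℝ] V, ∀ f w, B (R f) w = f w := by
  have hinj : Function.Injective B := (injective_iff_map_eq_zero B).2 fun v hv =>
    hB v (by rw [hv]; rfl)
  let e := LinearEquiv.ofInjectiveOfFinrankEq B hinj (Subspace.dual_finrank_eq (K := ℝ) (V := V)).symm
  exact ⟨e.symm, fun f w => congrArg (fun g : V →ₗ[ℝ] ℝ => g w) (e.apply_symm_apply f)⟩

theorem exists_riesz_range {M Y : Type*} [AddCommGroup M] [Module ℝ M] [FiniteDimensional ℝ M]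
    [AddCommGroup Y] [Module ℝ Y] (T : M →ₗ[ℝ] Y) (B : Y →ₗ[ℝ] Y →ₗ[ℝ] ℝ)
    (hB : ∀ y, B y y = 0 → y = 0) :
    ∃ E : (M →ₗ[ℝ] ℝ) →ₗ[ℝ] Y, ∀ l, E l ∈ LinearMap.range T ∧
      ((∀ w, T w = 0 → l w = 0) → ∀ w, B (E l) (T w) = l w) := by
  obtain ⟨s, hs⟩ := T.rangeRestrict.exists_rightInverse_of_surjective
    (LinearMap.range_eq_top.2 T.surjective_rangeRestrict)
  obtain ⟨R, hR⟩ := exists_riesz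
    (B.compl₁₂ (LinearMap.range T).subtype (LinearMap.range T).subtype)
    fun v hv => Subtype.ext (hB _ hv)
  refine ⟨(LinearMap.range T).subtype.comp (R.comp (LinearMap.lcomp ℝ ℝ s)),
    fun l => ⟨(R _).2, fun hl w => ?_⟩⟩
  refine (hR (LinearMap.lcomp ℝ ℝ s l) (T.rangeRestrict w)).trans ?_
  change l (s (T.rangeRestrict w)) = l w
  have h2 : T.rangeRestrict (s (T.rangeRestrict w)) = T.rangeRestrict w :=
    congrArg (fun f => f (T.rangeRestrict w)) hs
  have h3 : T (w - s (T.rangeRestrict w)) = 0 := by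
    rw [map_sub, sub_eq_zero]
    exact (congrArg Subtype.val h2).symm
  have h4 := hl _ h3
  rw [map_sub, sub_eq_zero] at h4
  exact h4.symm

variable {H X : Type*} [NormedAddCommGroup H] [NormedSpace ℝ H] [NormedAddCommGroup X]
  [NormedSpace ℝ X] {V : Submodule ℝ H} [FiniteDimensional ℝ V]

theorem exists_clm_extension (T : V →ₗ[ℝ] X) : ∃ L : H →L[ℝ] X, ∀ v : V, L v = T v := by
  obtain ⟨P, hP⟩ := Submodule.ClosedComplemented.of_finiteDimensional V
  exact ⟨T.toContinuousLinearMap.comp P, fun v => by simp [hP]⟩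

variable {I : Set ℝ} {u : ℝ → H}

theorem hasDerivWithinAt_of_linear (T : V →ₗ[ℝ] X) {u' : H} {g : ℝ → X} {t : ℝ} (ht : t ∈ I)
    (hu : ∀ s ∈ I, u s ∈ V) (hd : HasDerivWithinAt u u' I t) (hu' : u' ∈ V)
    (hg : ∀ s (hs : s ∈ I), g s = T ⟨u s, hu s hs⟩) : HasDerivWithinAt g (T ⟨u', hu'⟩) I t := by
  obtain ⟨L, hL⟩ := exists_clm_extension T
  rw [← hL]
  have h := L.hasFDerivAt.comp_hasDerivWithinAt t hd
  refine h.congr (fun s hs => ?_) ?_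
  · rw [hg s hs, ← hL]; rfl
  · rw [hg t ht, ← hL]; rfl

theorem hasDerivWithinAt_mem (hI : UniqueDiffOn ℝ I) {t : ℝ} {u' : H} (ht : t ∈ I)
    (hu : ∀ s ∈ I, u s ∈ V) (hd : HasDerivWithinAt u u' I t) : u' ∈ V := by
  obtain ⟨Q, hQ⟩ := Submodule.ClosedComplemented.of_finiteDimensional V
  have h2 : HasDerivWithinAt u (Q u' : H) I t :=
    ((V.subtypeL.comp Q).hasFDerivAt.comp_hasDerivWithinAt t hd).congr
      (fun s hs => by simp [hQ ⟨u s, hu s hs⟩]) (by simp [hQ ⟨u t, hu t ht⟩])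
  rw [(hI t ht).eq_deriv _ hd h2]
  exact (Q u').2

theorem uniqueDiffOn_of_ordConnected (hI : I.OrdConnected) (hI' : I.Nontrivial) :
    UniqueDiffOn ℝ I := by
  obtain ⟨a, ha, b, hb, hab⟩ := hI'.exists_lt
  refine uniqueDiffOn_convex hI.convex ⟨(a + b) / 2, ?_⟩
  refine interior_mono (hI.out ha hb) ?_
  rw [interior_Icc]
  constructor <;> linarith

theorem eq_of_hasDerivWithinAt_zero (hI : I.OrdConnected) (hI' : I.Nontrivial) {g : ℝ → X}
    (hg : ∀ t ∈ I, HasDerivWithinAt g 0 I t) {s t : ℝ} (hs : s ∈ I) (ht : t ∈ I) : g s = g t := by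
  refine hI.convex.is_const_of_fderivWithin_eq_zero (𝕜 := ℝ)
    (fun t ht => (hg t ht).differentiableWithinAt) (fun t ht => ?_) hs ht
  have := (hg t ht).hasFDerivWithinAt.fderivWithin (uniqueDiffOn_of_ordConnected hI hI' t ht)
  rw [this]
  ext
  simp

theorem mem_of_hasDerivWithinAt_mem (hI : I.OrdConnected) (hI' : I.Nontrivial) {u' : ℝ → H}
    (hu : ∀ t ∈ I, HasDerivWithinAt u (u' t) I t) (hu' : ∀ t ∈ I, u' t ∈ V) {t₀ : ℝ} (h₀ : t₀ ∈ I)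
    (hu₀ : u t₀ ∈ V) {t : ℝ} (ht : t ∈ I) : u t ∈ V := by
  obtain ⟨Q, hQ⟩ := Submodule.ClosedComplemented.of_finiteDimensional V
  have h1 : ∀ t ∈ I, HasDerivWithinAt (fun s => u s - (Q (u s) : H)) 0 I t := by
    intro t ht
    have h := (hu t ht).sub ((V.subtypeL.comp Q).hasFDerivAt.comp_hasDerivWithinAt t (hu t ht))
    have h2 : u' t - (V.subtypeL.comp Q) (u' t) = 0 := by
      simp [hQ ⟨u' t, hu' t ht⟩]
    rw [h2] at h
    exact h
  have h3 := eq_of_hasDerivWithinAt_zero hI hI' h1 ht h₀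
  have h4 : u t₀ - (Q (u t₀) : H) = 0 := by simp [hQ ⟨u t₀, hu₀⟩]
  simp only [h4] at h3
  rw [sub_eq_zero.1 h3]
  exact (Q (u t)).2

end LinearAlgebra

theorem integrable_apply_of_memLp {X E : Type*} [MeasurableSpace X] {μ : Measure X}
    [NormedAddCommGroup E] [NormedSpace ℝ E] {L : X → E →L[ℝ] ℝ} {v : X → E}
    (hL : MemLp L 2 μ) (hv : MemLp v 2 μ) : Integrable (fun x => L x (v x)) μ :=
  memLp_one_iff_integrable.1 ((ContinuousLinearMap.id ℝ (E →L[ℝ] ℝ)).memLp_of_bilin 1 hL hv)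

section Potential

variable {n : ℕ} {Ω : Set (Space n)} {k : Fin (n + 1)} {F : Potential n k} {I : Set ℝ}
  {S : Set (L2 Ω)}

/-! ### The potential -/

theorem memLp_component (v : L2 Ω) (k : Fin (n + 1)) :
    MemLp (fun x => v x k) 2 ((volume : Measure (Space n)).restrict Ω) :=
  (Lp.memLp v).of_le ((continuous_apply k).comp_aestronglyMeasurable (Lp.memLp v).1)
    (Eventually.of_forall fun x => norm_le_pi_norm (v x) k)

theorem integrable_source (hF : IsRegularPotential F I S) {t : ℝ} (ht : t ∈ I) {u : L2 Ω}
    (hu : u ∈ S) (v : L2 Ω) :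
    IntegrableOn (fun x => fderiv ℝ (F t x) (u x k) (v x k)) Ω :=
  integrable_apply_of_memLp (hF.source_mem t ht u hu) (memLp_component v k)

theorem source_add (hF : IsRegularPotential F I S) {t : ℝ} (ht : t ∈ I) {u : L2 Ω}
    (hu : u ∈ S) (v w : L2 Ω) : source F t u (v + w) = source F t u v + source F t u w := by
  rw [source, source, source,
    ← integral_add (integrable_source hF ht hu v) (integrable_source hF ht hu w)]
  refine integral_congr_ae ?_
  filter_upwards [Lp.coeFn_add v w] with x hx
  rw [hx, Pi.add_apply, Pi.add_apply, map_add]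

theorem source_smul (t : ℝ) (u : L2 Ω) (r : ℝ) (v : L2 Ω) :
    source F t u (r • v) = r * source F t u v := by
  rw [source, source, ← integral_const_mul]
  refine integral_congr_ae ?_
  filter_upwards [Lp.coeFn_smul r v] with x hx
  rw [hx, Pi.smul_apply, Pi.smul_apply, map_smul, smul_eq_mul]

theorem source_zero (t : ℝ) (u : L2 Ω) : source F t u 0 = 0 := by
  have := source_smul (F := F) t u 0 0
  rwa [zero_smul, zero_mul] at this

theorem hasDerivAt_potential (hF : IsRegularPotential F I S) {t : ℝ} (ht : t ∈ I) {u v : L2 Ω}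
    (hS : ∀ ε : ℝ, u + ε • v ∈ S) (hv : v ∈ S) :
    HasDerivAt (fun ε : ℝ => ∫ x in Ω, F t x ((u + ε • v : L2 Ω) x k)) (source F t u v) 0 := by
  have hu : u ∈ S := by simpa using hS 0
  have hae : ∀ ε : ℝ, ∀ᵐ x ∂((volume : Measure (Space n)).restrict Ω),
      (u + ε • v : L2 Ω) x k = u x k + ε • v x k := by
    intro ε
    filter_upwards [Lp.coeFn_add u (ε • v), Lp.coeFn_smul ε v] with x h1 h2
    rw [h1, Pi.add_apply, h2]
    rfl
  have hint : ∀ ε : ℝ, Integrable (fun x => F t x (u x k + ε • v x k))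
      ((volume : Measure (Space n)).restrict Ω) := fun ε =>
    (hF.integrable t ht _ (hS ε)).congr (by filter_upwards [hae ε] with x hx; rw [hx])
  obtain ⟨ε₀, hε₀, b, hb, hbd⟩ := hF.dominated t ht u hu v hv
  have h := (hasDerivAt_integral_of_dominated_loc_of_deriv_le
    (μ := (volume : Measure (Space n)).restrict Ω) (𝕜 := ℝ) (x₀ := (0 : ℝ))
    (F := fun ε x => F t x (u x k + ε • v x k))
    (F' := fun ε x => fderiv ℝ (F t x) (u x k + ε • v x k) (v x k)) (bound := b)
    (Metric.ball_mem_nhds (0 : ℝ) hε₀)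
    (Eventually.of_forall fun ε => (hint ε).1) (hint 0) ?_ ?_ hb ?_).2
  · have h0 : ∫ x in Ω, fderiv ℝ (F t x) (u x k + (0 : ℝ) • v x k) (v x k) = source F t u v := by
      simp only [zero_smul, add_zero, source]
    rw [h0] at h
    refine h.congr_of_eventuallyEq (Eventually.of_forall fun ε => integral_congr_ae ?_)
    filter_upwards [hae ε] with x hx
    rw [hx]
  · simp only [zero_smul, add_zero]
    exact (integrable_source hF ht hu v).1
  · filter_upwards [hbd] with x hx ε hε
    exact hx ε (by simpa using hε)
  · filter_upwards [hF.differentiable t ht] with x hx ε _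
    have h1 : HasDerivAt (fun ε : ℝ => u x k + ε • v x k) (v x k) ε := by
      simpa using ((hasDerivAt_id ε).smul_const (v x k)).const_add (u x k)
    exact (hx _).hasFDerivAt.comp_hasDerivAt ε h1

theorem hasDerivAt_ip_self (a b : L2 Ω) :
    HasDerivAt (fun ε : ℝ => ip Ω (a + ε • b : L2 Ω) (a + ε • b : L2 Ω)) (2 * ip Ω a b) 0 := by
  have h : (fun ε : ℝ => ip Ω (a + ε • b : L2 Ω) (a + ε • b : L2 Ω)) =
      fun ε => ip Ω a a + ε * (2 * ip Ω a b) + ε ^ 2 * ip Ω b b := by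
    funext ε
    simp only [ip_eq_pairL, map_add, map_smul, LinearMap.add_apply, LinearMap.smul_apply,
      smul_eq_mul]
    rw [pairL_comm b a]
    ring
  rw [h]
  have h1 := (((hasDerivAt_id (0 : ℝ)).mul_const (2 * ip Ω a b)).const_add (ip Ω a a)).add
    (((hasDerivAt_id (0 : ℝ)).pow 2).mul_const (ip Ω b b))
  exact h1.congr_deriv (by simp)

end Potential

section Constraints

variable {n : ℕ} {ι : Type*} [Fintype ι] {Ω : Set (Space n)} {K : ι → Set (Space n)}
  {W : (i : ι) → ℤ → Submodule ℝ (L2 (K i))} {k : Fin (n + 1)}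

/-! ### The constraints -/

theorem eq_of_forall_ip {V : Submodule ℝ (L2 Ω)} {a b : L2 Ω} (ha : a ∈ V) (hb : b ∈ V)
    (h : ∀ v ∈ V, ip Ω a v = ip Ω b v) : a = b := by
  rw [← sub_eq_zero]
  refine pairL_self_eq_zero ?_
  have := h _ (V.sub_mem ha hb)
  rw [ip_eq_pairL, ip_eq_pairL] at this
  rw [LinearMap.map_sub₂, this, sub_self]

theorem exists_isSigma (hK : IsMesh Ω K) (hW : IsLocalComplex K W) (k : Fin (n + 1)) :
    ∃ S : L2 Ω →ₗ[ℝ] L2 Ω, ∀ u, IsSigma W k u (S u) := by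
  let V := confSub hK hW ((k : ℕ) - 1)
  have := finiteDimensional_confSub hK hW ((k : ℕ) - 1)
  obtain ⟨R, hR⟩ := exists_riesz ((pairL (volume.restrict Ω)).compl₁₂ V.subtype V.subtype)
    fun v hv => Subtype.ext (pairL_self_eq_zero hv)
  let D : V →ₗ[ℝ] L2 Ω :=
    (brokenDL hK hW ((k : ℕ) - 1)).comp (Submodule.inclusion (confSub_le hK hW ((k : ℕ) - 1)))
  refine ⟨V.subtype.comp (R.comp (-((pairL (volume.restrict Ω)).compl₂ D))),
    fun u => ⟨(R _).2, fun τ hτ => ?_⟩⟩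
  have h := hR (-((pairL (volume.restrict Ω)).compl₂ D u)) ⟨τ, hτ⟩
  rw [weakD_eq_brokenD hK hW hτ]
  exact (neg_eq_iff_eq_neg.2 h).symm

theorem IsSigma.unique (hK : IsMesh Ω K) (hW : IsLocalComplex K W) {u σ σ' : L2 Ω}
    (h : IsSigma W k u σ) (h' : IsSigma W k u σ') : σ = σ' :=
  eq_of_forall_ip (V := confSub hK hW ((k : ℕ) - 1)) h.1 h'.1 fun τ hτ =>
    neg_injective ((h.2 τ hτ).symm.trans (h'.2 τ hτ))

theorem isSigma_sigmaOf (hK : IsMesh Ω K) (hW : IsLocalComplex K W) (u : L2 Ω) :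
    IsSigma W k u (sigmaOf W k u) := by
  obtain ⟨S, hS⟩ := exists_isSigma hK hW k
  have h : ∃ σ, IsSigma W k u σ := ⟨_, hS u⟩
  rw [sigmaOf, dif_pos h]
  exact h.choose_spec

theorem isSigma_iff (hK : IsMesh Ω K) (hW : IsLocalComplex K W) {u σ : L2 Ω} :
    IsSigma W k u σ ↔ σ = sigmaOf W k u :=
  ⟨fun h => h.unique hK hW (isSigma_sigmaOf hK hW u), fun h => h ▸ isSigma_sigmaOf hK hW u⟩

theorem exists_sigmaOf_eq (hK : IsMesh Ω K) (hW : IsLocalComplex K W) (k : Fin (n + 1)) :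
    ∃ S : L2 Ω →ₗ[ℝ] L2 Ω, ∀ u, sigmaOf W k u = S u := by
  obtain ⟨S, hS⟩ := exists_isSigma hK hW k
  exact ⟨S, fun u => ((isSigma_iff hK hW).1 (hS u)).symm⟩

theorem isRho_iff_neg (hK : IsMesh Ω K) (hW : IsLocalComplex K W) {u ρ : L2 Ω}
    (hu : u ∈ conf Ω W (k : ℕ)) : IsRho W k u ρ ↔ ρ = -brokenD K u := by
  have hd := brokenD_mem_conf hK hW hu
  constructor
  · intro h
    refine eq_of_forall_ip (V := confSub hK hW ((k : ℕ) + 1)) h.1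
      ((confSub hK hW ((k : ℕ) + 1)).neg_mem hd) fun η hη => ?_
    have := h.2 η hη
    rw [weakD_eq_brokenD hK hW hu] at this
    simp only [ip_eq_pairL, map_neg, LinearMap.neg_apply] at this ⊢
    rw [this, neg_neg]
  · rintro rfl
    refine ⟨(confSub hK hW ((k : ℕ) + 1)).neg_mem hd, fun η _ => ?_⟩
    rw [weakD_eq_brokenD hK hW hu]
    simp only [ip_eq_pairL, map_neg, LinearMap.neg_apply, neg_neg]

theorem rhoOf_eq (hK : IsMesh Ω K) (hW : IsLocalComplex K W) {u : L2 Ω}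
    (hu : u ∈ conf Ω W (k : ℕ)) : rhoOf W k u = -brokenD K u := by
  have h : ∃ ρ, IsRho W k u ρ := ⟨_, (isRho_iff_neg hK hW hu).2 rfl⟩
  rw [rhoOf, dif_pos h]
  exact (isRho_iff_neg hK hW hu).1 h.choose_spec

theorem isRho_iff (hK : IsMesh Ω K) (hW : IsLocalComplex K W) {u ρ : L2 Ω}
    (hu : u ∈ conf Ω W (k : ℕ)) : IsRho W k u ρ ↔ ρ = rhoOf W k u := by
  rw [isRho_iff_neg hK hW hu, rhoOf_eq hK hW hu]

/-! ### The Hamiltonian -/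

theorem hasDerivAt_hamiltonian (hK : IsMesh Ω K) (hW : IsLocalComplex K W)
    {F : Potential n k} {I : Set ℝ} (hF : IsRegularPotential F I (broken Ω W (k : ℕ)))
    {t : ℝ} (ht : t ∈ I) {u v : L2 Ω} (hu : u ∈ conf Ω W (k : ℕ)) (hv : v ∈ conf Ω W (k : ℕ))
    (p r : L2 Ω) :
    HasDerivAt (fun ε : ℝ => hamiltonian W k F t (u + ε • v) (p + ε • r))
      (-ip Ω (weakD (sigmaOf W k u)) v - ip Ω (rhoOf W k u) (weakD v) + source F t u v
        + ip Ω p r) 0 := by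
  obtain ⟨S, hS⟩ := exists_sigmaOf_eq hK hW k
  have hρ : ∀ ε : ℝ, rhoOf W k (u + ε • v) = rhoOf W k u + ε • rhoOf W k v := by
    intro ε
    have hεv : ε • v ∈ conf Ω W (k : ℕ) := (confSub hK hW (k : ℕ)).smul_mem ε hv
    rw [rhoOf_eq hK hW hu, rhoOf_eq hK hW hv,
      rhoOf_eq hK hW ((confSub hK hW (k : ℕ)).add_mem hu hεv),
      brokenD_add hK hW hu.1 hεv.1, brokenD_smul hK hW ε hv.1, neg_add, smul_neg]
  have hσ : ∀ ε : ℝ, sigmaOf W k (u + ε • v) = sigmaOf W k u + ε • sigmaOf W k v := by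
    intro ε
    rw [hS, hS, hS, map_add, map_smul]
  have hσv := (isSigma_sigmaOf hK hW (k := k) v).2 _ (isSigma_sigmaOf hK hW (k := k) u).1
  have hρv := ((isRho_iff hK hW hv).2 rfl).2 _ ((isRho_iff hK hW hu).2 rfl).1
  have h := ((((hasDerivAt_ip_self (sigmaOf W k u) (sigmaOf W k v)).add
    (hasDerivAt_ip_self p r)).add (hasDerivAt_ip_self (rhoOf W k u) (rhoOf W k v))).const_mul
      (1 / 2 : ℝ)).add (hasDerivAt_potential hF ht (u := u) (v := v)
        (fun ε => (brokenSub hK W (k : ℕ)).add_mem hu.1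
          ((brokenSub hK W (k : ℕ)).smul_mem ε hv.1)) hv.1)
  refine (h.congr_of_eventuallyEq (Eventually.of_forall fun ε => ?_)).congr_deriv ?_
  · simp only [hamiltonian, hσ ε, hρ ε]
    rfl
  simp only [ip_eq_pairL] at hσv hρv ⊢
  rw [pairL_comm (weakD (sigmaOf W k u)) v, hσv, pairL_comm (rhoOf W k u) (weakD v), hρv,
    pairL_comm (sigmaOf W k v), pairL_comm (rhoOf W k v)]
  ring

end Constraints

section Equivalence

variable {n : ℕ} {ι : Type*} [Fintype ι] {Ω : Set (Space n)} {K : ι → Set (Space n)}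
  {W : (i : ι) → ℤ → Submodule ℝ (L2 (K i))} {k : Fin (n + 1)} {F : Potential n k} {I : Set ℝ}
  {z : Curves Ω}

/-! ### Recovery of the normal traces -/

theorem eq_of_forall_ipBT (hK : IsMesh Ω K) (hW : IsLocalComplex K W) {j : ℤ}
    {g g' : (i : ι) → L2B (K i)} (hg : g ∈ traceSpace W j) (hg' : g' ∈ traceSpace W j)
    (h : ∀ τ ∈ broken Ω W j, ipBT g (tanT K τ) = ipBT g' (tanT K τ)) : g = g' := by
  rw [← sub_eq_zero]
  refine ipBTL_self_eq_zero ?_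
  obtain ⟨τ, hτ, hτg⟩ := (mem_traceSpace_iff hK).1 ((mem_traceSub hK hW).1
    ((traceSub hK hW j).sub_mem ((mem_traceSub hK hW).2 hg) ((mem_traceSub hK hW).2 hg')))
  rw [← hτg, hτg, LinearMap.map_sub₂, ← hτg, ipBTL_apply, ipBTL_apply, h τ hτ, sub_self]

/-- A functional on the broken space that vanishes on the conforming space is represented by a
normal trace. -/
theorem exists_trace (hK : IsMesh Ω K) (hW : IsLocalComplex K W) (j : ℤ) :
    ∃ E : (brokenSub hK W j →ₗ[ℝ] ℝ) →ₗ[ℝ] ((i : ι) → L2B (K i)), ∀ l,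
      E l ∈ traceSpace W j ∧ ((∀ w : brokenSub hK W j, (w : L2 Ω) ∈ conf Ω W j → l w = 0) →
        ∀ w : brokenSub hK W j, ipBT (E l) (tanT K (w : L2 Ω)) = l w) := by
  have := finiteDimensional_brokenSub hK hW j
  obtain ⟨E, hE⟩ := exists_riesz_range (tanTL hK hW j) (ipBTL K) fun _ => ipBTL_self_eq_zero
  refine ⟨E, fun l => ⟨(mem_traceSub hK hW).1 (hE l).1, fun hl w => ?_⟩⟩
  rw [← ipBTL_apply]
  refine (hE l).2 (fun v hv => hl v ⟨v.2, ?_⟩) w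
  have h4 : tanT K (v : L2 Ω) = 0 := hv
  rw [h4, hK.noJump_iff]
  intro φ hφ
  refine Finset.sum_eq_zero fun i _ => ?_
  have := hK.isFiniteMeasure_surf i
  rw [ipB_eq_pairL _ hφ, Pi.zero_apply, map_zero, LinearMap.zero_apply]

/-! ### The conforming method and Hamilton's equations -/

theorem zero_mem_conf (hK : IsMesh Ω K) (hW : IsLocalComplex K W) (j : ℤ) :
    (0 : L2 Ω) ∈ conf Ω W j := (confSub hK hW j).zero_mem

theorem isAFW1_iff (hK : IsMesh Ω K) (hW : IsLocalComplex K W)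
    (hF : IsRegularPotential F I (broken Ω W (k : ℕ))) :
    IsAFW1 W k F I z ↔ IsHamiltonian W k F I z.u z.p ∧ IsRecovered W k I z := by
  constructor
  · intro h
    have hrec : IsRecovered W k I z := fun t ht =>
      ⟨(isSigma_iff hK hW).1 (h.eq_σ t ht), (isRho_iff hK hW (h.u_mem t ht)).1 (h.eq_ρ t ht)⟩
    refine ⟨⟨h.u_mem, h.p_mem, h.diff_u, h.diff_p, fun t ht v hv r hr => ?_⟩, hrec⟩
    refine (hasDerivAt_hamiltonian hK hW hF ht (h.u_mem t ht) hv (z.p t) r).congr_deriv ?_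
    have h1 := h.eq_u t ht r hr
    have h2 := h.eq_p t ht v hv
    rw [(hrec t ht).1, (hrec t ht).2] at h2
    linarith
  · rintro ⟨h, hrec⟩
    have key : ∀ t ∈ I, ∀ v ∈ conf Ω W (k : ℕ), ∀ r ∈ conf Ω W (k : ℕ),
        -ip Ω (derivWithin z.p I t : L2 Ω) v + ip Ω (derivWithin z.u I t : L2 Ω) r =
          -ip Ω (weakD (z.σ t)) v - ip Ω (z.ρ t) (weakD v) + source F t (z.u t) v
            + ip Ω (z.p t) r := by
      intro t ht v hv r hr
      rw [(hrec t ht).1, (hrec t ht).2]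
      exact (h.eq t ht v hv r hr).unique
        (hasDerivAt_hamiltonian hK hW hF ht (h.u_mem t ht) hv (z.p t) r)
    have h0 := zero_mem_conf hK hW (W := W) (k : ℕ)
    refine ⟨h.u_mem, h.p_mem, h.diff_u, h.diff_p, fun t ht r hr => ?_, fun t ht v hv => ?_,
      fun t ht => (isSigma_iff hK hW).2 (hrec t ht).1,
      fun t ht => (isRho_iff hK hW (h.u_mem t ht)).2 (hrec t ht).2⟩
    · have h1 := key t ht 0 h0 r hr
      have h2 : weakD (0 : L2 Ω) = 0 := by
        have := brokenD_smul hK hW 0 h0.1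
        rw [zero_smul, zero_smul] at this
        rw [weakD_eq_brokenD hK hW h0, this]
      rw [h2, source_zero] at h1
      simpa only [ip_eq_pairL, map_zero, neg_zero, zero_add, sub_zero] using h1
    · have h1 := key t ht v hv 0 h0
      simp only [ip_eq_pairL, map_zero, add_zero] at h1 ⊢
      linarith

/-! ### The two formulations of the conforming method -/

/-- Pairing with a fixed form on a subspace. -/
noncomputable def pairOn (V : Submodule ℝ (L2 Ω)) (a : L2 Ω) : V →ₗ[ℝ] ℝ :=
  ((pairL (volume.restrict Ω)).flip a).comp V.subtype

theorem pairOn_apply (V : Submodule ℝ (L2 Ω)) (a : L2 Ω) (v : V) :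
    pairOn V a v = ip Ω (v : L2 Ω) a := rfl

theorem IsAFW1.deriv_u (hI : I.OrdConnected) (hI' : I.Nontrivial)
    (hK : IsMesh Ω K) (hW : IsLocalComplex K W) (h : IsAFW1 W k F I z)
    {t : ℝ} (ht : t ∈ I) : derivWithin z.u I t = z.p t := by
  have := finiteDimensional_confSub hK hW (k : ℕ)
  exact eq_of_forall_ip (V := confSub hK hW (k : ℕ))
    (hasDerivWithinAt_mem (uniqueDiffOn_of_ordConnected hI hI') ht h.u_mem
      (h.diff_u t ht).hasDerivWithinAt) (h.p_mem t ht) (h.eq_u t ht)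

theorem IsAFW1.hasDerivWithinAt_u (hI : I.OrdConnected) (hI' : I.Nontrivial)
    (hK : IsMesh Ω K) (hW : IsLocalComplex K W)
    (h : IsAFW1 W k F I z) {t : ℝ} (ht : t ∈ I) : HasDerivWithinAt z.u (z.p t) I t := by
  rw [← h.deriv_u hI hI' hK hW ht]
  exact (h.diff_u t ht).hasDerivWithinAt

theorem IsAFW1.isAFW2 (hI : I.OrdConnected) (hI' : I.Nontrivial)
    (hK : IsMesh Ω K) (hW : IsLocalComplex K W) (h : IsAFW1 W k F I z)
    {t₀ : ℝ} (h₀ : t₀ ∈ I) : IsAFW2 W k F I t₀ z := by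
  have hu := uniqueDiffOn_of_ordConnected hI hI'
  have := finiteDimensional_confSub hK hW (k : ℕ)
  obtain ⟨S, hS⟩ := exists_sigmaOf_eq hK hW k
  have hσ : ∀ t ∈ I, HasDerivWithinAt z.σ (S (z.p t)) I t := fun t ht =>
    hasDerivWithinAt_of_linear (V := confSub hK hW (k : ℕ)) (S.comp (confSub hK hW _).subtype) ht
      h.u_mem (h.hasDerivWithinAt_u hI hI' hK hW ht) (h.p_mem t ht) fun s hs => by
        rw [(isSigma_iff hK hW).1 (h.eq_σ s hs), hS]; rfl
  have hρ : ∀ t ∈ I, HasDerivWithinAt z.ρ (-brokenD K (z.p t)) I t := fun t ht =>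
    hasDerivWithinAt_of_linear (V := confSub hK hW (k : ℕ))
      (-((brokenDL hK hW (k : ℕ)).comp (Submodule.inclusion (confSub_le hK hW (k : ℕ))))) ht
      h.u_mem (h.hasDerivWithinAt_u hI hI' hK hW ht) (h.p_mem t ht) fun s hs => by
        rw [(isRho_iff_neg hK hW (h.u_mem s hs)).1 (h.eq_ρ s hs)]; rfl
  refine ⟨fun t ht => (h.eq_σ t ht).1, h.u_mem, fun t ht => (h.eq_ρ t ht).1, h.p_mem,
    fun t ht => (hσ t ht).differentiableWithinAt, h.diff_u,
    fun t ht => (hρ t ht).differentiableWithinAt, h.diff_p, fun t ht τ hτ => ?_, h.eq_u,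
    fun t ht η hη => ?_, h.eq_p, ⟨h.eq_σ t₀ h₀, h.eq_ρ t₀ h₀⟩⟩
  · rw [(hσ t ht).derivWithin (hu t ht), ← hS]
    have := (isSigma_sigmaOf hK hW (k := k) (z.p t)).2 τ hτ
    linarith
  · rw [(hρ t ht).derivWithin (hu t ht), weakD_eq_brokenD hK hW (h.p_mem t ht)]
    simp only [ip_eq_pairL, map_neg, LinearMap.neg_apply, neg_add_cancel]

theorem IsAFW2.isAFW1 (hI : I.OrdConnected) (hI' : I.Nontrivial)
    (hK : IsMesh Ω K) (hW : IsLocalComplex K W) {t₀ : ℝ} (h₀ : t₀ ∈ I)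
    (h : IsAFW2 W k F I t₀ z) : IsAFW1 W k F I z := by
  have hu := uniqueDiffOn_of_ordConnected hI hI'
  have hfin := finiteDimensional_confSub hK hW
  have hd : ∀ t ∈ I, HasDerivWithinAt z.u (z.p t) I t := fun t ht => by
    have h1 : derivWithin z.u I t = z.p t := eq_of_forall_ip (V := confSub hK hW (k : ℕ))
      (hasDerivWithinAt_mem hu ht h.u_mem (h.diff_u t ht).hasDerivWithinAt) (h.p_mem t ht)
      (h.eq_u t ht)
    rw [← h1]
    exact (h.diff_u t ht).hasDerivWithinAt
  refine ⟨h.u_mem, h.p_mem, h.diff_u, h.diff_p, h.eq_u, h.eq_p,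
    fun t ht => ⟨h.σ_mem t ht, fun τ hτ => ?_⟩, fun t ht => ⟨h.ρ_mem t ht, fun η hη => ?_⟩⟩
  · have hc : ∀ s ∈ I, HasDerivWithinAt
        (fun s => ip Ω (z.u s) (weakD τ) + ip Ω (z.σ s) τ) 0 I s := fun s hs => by
      have h1 := hasDerivWithinAt_of_linear (pairOn (confSub hK hW (k : ℕ)) (weakD τ)) hs h.u_mem
        (hd s hs) (h.p_mem s hs) (g := fun s => ip Ω (z.u s) (weakD τ)) fun _ _ => rfl
      have hσd := (h.diff_σ s hs).hasDerivWithinAt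
      have h2 := hasDerivWithinAt_of_linear (pairOn (confSub hK hW ((k : ℕ) - 1)) τ) hs h.σ_mem
        hσd (hasDerivWithinAt_mem hu hs h.σ_mem hσd) (g := fun s => ip Ω (z.σ s) τ) fun _ _ => rfl
      refine (h1.add h2).congr_deriv ?_
      have := h.eq_σ s hs τ hτ
      simp only [pairOn_apply]
      linarith
    have h1 := eq_of_hasDerivWithinAt_zero hI hI' hc ht h₀
    have h2 := h.initial.1.2 τ hτ
    linarith
  · have hc : ∀ s ∈ I, HasDerivWithinAt
        (fun s => ip Ω (weakD (z.u s)) η + ip Ω (z.ρ s) η) 0 I s := fun s hs => by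
      have h1 := hasDerivWithinAt_of_linear (V := confSub hK hW (k : ℕ))
        ((pairOn ⊤ η).comp ((LinearMap.codRestrict ⊤ ((brokenDL hK hW (k : ℕ)).comp
          (Submodule.inclusion (confSub_le hK hW (k : ℕ)))) fun _ => trivial))) hs h.u_mem
        (hd s hs) (h.p_mem s hs) (g := fun s => ip Ω (weakD (z.u s)) η) fun s hs => by
          rw [weakD_eq_brokenD hK hW (h.u_mem s hs)]; rfl
      have hρd := (h.diff_ρ s hs).hasDerivWithinAt
      have h2 := hasDerivWithinAt_of_linear (pairOn (confSub hK hW ((k : ℕ) + 1)) η) hs h.ρ_mem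
        hρd (hasDerivWithinAt_mem hu hs h.ρ_mem hρd) (g := fun s => ip Ω (z.ρ s) η) fun _ _ => rfl
      refine (h1.add h2).congr_deriv ?_
      have h3 := h.eq_ρ s hs η hη
      rw [weakD_eq_brokenD hK hW (h.p_mem s hs)] at h3
      have h4 : ∀ a b : ℝ, b + a = 0 → a + b = 0 := fun a b hab => by linarith
      exact h4 _ _ h3
    have h1 := eq_of_hasDerivWithinAt_zero hI hI' hc ht h₀
    have h2 := h.initial.2.2 η hη
    linarith

end Equivalence

section Hybrid

variable {n : ℕ} {ι : Type*} [Fintype ι] {Ω : Set (Space n)} {K : ι → Set (Space n)}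
  {W : (i : ι) → ℤ → Submodule ℝ (L2 (K i))} {k : Fin (n + 1)} {F : Potential n k} {I : Set ℝ}
  {z : Curves Ω} {y : TraceCurves K}

/-! ### The equations of the hybrid method -/

theorem tanT_mem_confTrace {j : ℤ} {w : L2 Ω} (hw : w ∈ conf Ω W j) : tanT K w ∈ confTrace W j :=
  ⟨fun i => ⟨_, hw.1 i, rfl⟩, hw.2⟩

theorem EqU.eq (hK : IsMesh Ω K) {u' p : L2 Ω} (hu : u' ∈ broken Ω W (k : ℕ))
    (hp : p ∈ broken Ω W (k : ℕ)) (h : EqU W k u' p) : u' = p :=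
  eq_of_forall_ip (V := brokenSub hK W (k : ℕ)) hu hp fun r hr => by
    rw [hK.ip_eq_ipT, hK.ip_eq_ipT]
    exact h r hr

theorem EqTau.isSigma (hK : IsMesh Ω K) (hW : IsLocalComplex K W) {u σ : L2 Ω}
    {un : (i : ι) → L2B (K i)} (h : EqTau W k u σ un) (hc : Conservative W ((k : ℕ) - 1) un)
    (hσ : σ ∈ conf Ω W ((k : ℕ) - 1)) : IsSigma W k u σ := by
  refine ⟨hσ, fun τ hτ => ?_⟩
  have h1 := h τ hτ.1
  rw [hc _ (tanT_mem_confTrace hτ), hK.ipT_res_dT, ← hK.ip_eq_ipT, sub_zero] at h1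
  rw [weakD_eq_brokenD hK hW hτ, h1]

theorem ipT_deltaT_add_tanT (hK : IsMesh Ω K) (hW : IsLocalComplex K W) {j l : ℤ} {w v : L2 Ω}
    (hw : w ∈ broken Ω W j) (hv : v ∈ broken Ω W l) :
    ipT (res K w) (deltaT K v) + ipBT (tanT K w) (norT K v) = ip Ω (brokenD K w) v := by
  rw [ipBT_tanT_norT hK hW hw hv]
  ring

theorem eqEta_iff (hK : IsMesh Ω K) (hW : IsLocalComplex K W) {u ρ : L2 Ω}
    (hu : u ∈ broken Ω W (k : ℕ)) (hρ : ρ ∈ broken Ω W ((k : ℕ) + 1)) :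
    EqEta W k u ρ (tanT K u) ↔ ρ = -brokenD K u := by
  have hd := brokenD_mem hK hW hu
  constructor
  · intro h
    refine eq_of_forall_ip (V := brokenSub hK W ((k : ℕ) + 1)) hρ
      ((brokenSub hK W ((k : ℕ) + 1)).neg_mem hd) fun η hη => ?_
    have h1 := h η hη
    rw [ipT_deltaT_add_tanT hK hW hu hη, ← hK.ip_eq_ipT] at h1
    simp only [ip_eq_pairL, map_neg, LinearMap.neg_apply] at h1 ⊢
    rw [h1, neg_neg]
  · rintro rfl η hη
    rw [ipT_deltaT_add_tanT hK hW hu hη, ← hK.ip_eq_ipT]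
    simp only [ip_eq_pairL, map_neg, LinearMap.neg_apply, neg_neg]

theorem eqRhoDot_iff (hK : IsMesh Ω K) (hW : IsLocalComplex K W) {p ρ' : L2 Ω}
    (hp : p ∈ broken Ω W (k : ℕ)) (hρ : ρ' ∈ broken Ω W ((k : ℕ) + 1)) :
    EqRhoDot W k ρ' p (tanT K p) ↔ ρ' = -brokenD K p := by
  rw [← eqEta_iff hK hW hp hρ]
  refine forall₂_congr fun η hη => ?_
  constructor <;> intro h <;> linarith

theorem EqP.confEqP (hK : IsMesh Ω K) (hW : IsLocalComplex K W) {t : ℝ} {u p' σ ρ : L2 Ω}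
    {ρn : (i : ι) → L2B (K i)} (hσ : σ ∈ conf Ω W ((k : ℕ) - 1))
    (h : EqP W k F t u p' σ ρ (tanT K σ) ρn) (hc : Conservative W (k : ℕ) ρn) :
    ConfEqP W k F t u p' σ ρ := by
  intro v hv
  have h1 := h v hv.1
  have h2 := ipT_deltaT_add_tanT hK hW hσ.1 hv.1
  rw [hc _ (tanT_mem_confTrace hv), hK.ipT_res_dT, ← hK.ip_eq_ipT] at h1
  rw [weakD_eq_brokenD hK hW hσ, weakD_eq_brokenD hK hW hv]
  linarith

theorem HybridConstraints.mem_conf (hK : IsMesh Ω K) (hW : IsLocalComplex K W) {σ u ρ : L2 Ω}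
    (h : HybridConstraints W k σ u ρ) (hu : u ∈ broken Ω W (k : ℕ)) : u ∈ conf Ω W (k : ℕ) := by
  obtain ⟨un, -, ut, hut, -, -, hfl, -⟩ := h
  exact hfl.mem_conf hK hW hut hu

theorem HybridConstraints.isRho (hK : IsMesh Ω K) (hW : IsLocalComplex K W) {σ u ρ : L2 Ω}
    (h : HybridConstraints W k σ u ρ) (hu : u ∈ broken Ω W (k : ℕ))
    (hρ : ρ ∈ broken Ω W ((k : ℕ) + 1)) : IsRho W k u ρ := by
  have huc := h.mem_conf hK hW hu
  obtain ⟨un, -, ut, hut, -, hη, hfl, -⟩ := h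
  rw [hfl.eq hK hW hut.1 hu, eqEta_iff hK hW hu hρ] at hη
  exact (isRho_iff_neg hK hW huc).2 hη

theorem HybridConstraints.isSigma (hK : IsMesh Ω K) (hW : IsLocalComplex K W) {σ u ρ : L2 Ω}
    (h : HybridConstraints W k σ u ρ) (hσ : σ ∈ conf Ω W ((k : ℕ) - 1)) : IsSigma W k u σ := by
  obtain ⟨un, -, ut, -, hτ, -, -, hc⟩ := h
  exact hτ.isSigma hK hW hc hσ

/-! ### The implementations of the hybrid method -/

theorem IsAFWH.isAFWH1 (h : IsAFWH W k F I z y) : IsAFWH1 W k F I z y :=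
  ⟨h.mem, h.σt_mem, h.ut_mem, h.un_mem, h.ρn_mem, h.diff_u, h.diff_p, h.eq_u, h.eq_p, h.eq_tau,
    h.eq_eta, h.flux_σ, h.flux_u, h.cons_u, h.cons_ρ⟩

theorem IsAFWH.isAFWH2 (h : IsAFWH W k F I z y) {t₀ : ℝ} (h₀ : t₀ ∈ I) :
    IsAFWH2 W k F I t₀ z y :=
  ⟨h.mem, h.σt_mem, h.pt_mem, h.pn_mem, h.ρn_mem, h.diff_σ, h.diff_u, h.diff_ρ, h.diff_p, h.eq_σ,
    h.eq_u, h.eq_ρ, h.eq_p, h.flux_σ, h.flux_p, h.cons_p, h.cons_ρ,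
    ⟨y.un t₀, h.un_mem t₀ h₀, y.ut t₀, h.ut_mem t₀ h₀, h.eq_tau t₀ h₀, h.eq_eta t₀ h₀,
      h.flux_u t₀ h₀, h.cons_u t₀ h₀⟩⟩

theorem IsAFWH1.isAFW1 (hI : I.OrdConnected) (hI' : I.Nontrivial) (hK : IsMesh Ω K)
    (hW : IsLocalComplex K W) (h : IsAFWH1 W k F I z y) : IsAFW1 W k F I z := by
  have hu := uniqueDiffOn_of_ordConnected hI hI'
  have := finiteDimensional_confSub hK hW (k : ℕ)
  have hσ : ∀ t ∈ I, z.σ t ∈ conf Ω W ((k : ℕ) - 1) := fun t ht =>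
    (h.flux_σ t ht).mem_conf hK hW (h.σt_mem t ht) (h.mem.σ_mem t ht)
  have hc : ∀ t ∈ I, HybridConstraints W k (z.σ t) (z.u t) (z.ρ t) := fun t ht =>
    ⟨y.un t, h.un_mem t ht, y.ut t, h.ut_mem t ht, h.eq_tau t ht, h.eq_eta t ht, h.flux_u t ht,
      h.cons_u t ht⟩
  have huc : ∀ t ∈ I, z.u t ∈ conf Ω W (k : ℕ) := fun t ht =>
    (hc t ht).mem_conf hK hW (h.mem.u_mem t ht)
  have hd : ∀ t ∈ I, derivWithin z.u I t ∈ conf Ω W (k : ℕ) := fun t ht =>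
    hasDerivWithinAt_mem (V := confSub hK hW (k : ℕ)) hu ht huc (h.diff_u t ht).hasDerivWithinAt
  have hp : ∀ t ∈ I, derivWithin z.u I t = z.p t := fun t ht =>
    (h.eq_u t ht).eq hK (hd t ht).1 (h.mem.p_mem t ht)
  refine ⟨huc, fun t ht => hp t ht ▸ hd t ht, h.diff_u, h.diff_p, fun t ht r _ => by rw [hp t ht],
    fun t ht => ?_, fun t ht => (hc t ht).isSigma hK hW (hσ t ht),
    fun t ht => (hc t ht).isRho hK hW (h.mem.u_mem t ht) (h.mem.ρ_mem t ht)⟩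
  have h1 := h.eq_p t ht
  rw [(h.flux_σ t ht).eq hK hW (h.σt_mem t ht).1 (h.mem.σ_mem t ht)] at h1
  exact h1.confEqP hK hW (hσ t ht) (h.cons_ρ t ht)

theorem IsAFWH2.isAFW2 (hI : I.OrdConnected) (hI' : I.Nontrivial) (hK : IsMesh Ω K)
    (hW : IsLocalComplex K W) {t₀ : ℝ} (h₀ : t₀ ∈ I) (h : IsAFWH2 W k F I t₀ z y) :
    IsAFW2 W k F I t₀ z := by
  have hu := uniqueDiffOn_of_ordConnected hI hI'
  have hfin := finiteDimensional_confSub hK hW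
  have hfin' := finiteDimensional_brokenSub hK hW
  have hσ : ∀ t ∈ I, z.σ t ∈ conf Ω W ((k : ℕ) - 1) := fun t ht =>
    (h.flux_σ t ht).mem_conf hK hW (h.σt_mem t ht) (h.mem.σ_mem t ht)
  have hp : ∀ t ∈ I, z.p t ∈ conf Ω W (k : ℕ) := fun t ht =>
    (h.flux_p t ht).mem_conf hK hW (h.pt_mem t ht) (h.mem.p_mem t ht)
  have hu' : ∀ t ∈ I, derivWithin z.u I t = z.p t := fun t ht =>
    (h.eq_u t ht).eq hK (hasDerivWithinAt_mem (V := brokenSub hK W (k : ℕ)) hu ht h.mem.u_mem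
      (h.diff_u t ht).hasDerivWithinAt) (h.mem.p_mem t ht)
  have hρ' : ∀ t ∈ I, derivWithin z.ρ I t = -brokenD K (z.p t) := fun t ht => by
    have h1 := h.eq_ρ t ht
    rw [(h.flux_p t ht).eq hK hW (h.pt_mem t ht).1 (h.mem.p_mem t ht)] at h1
    exact (eqRhoDot_iff hK hW (h.mem.p_mem t ht) (hasDerivWithinAt_mem
      (V := brokenSub hK W ((k : ℕ) + 1)) hu ht h.mem.ρ_mem
      (h.diff_ρ t ht).hasDerivWithinAt)).1 h1
  have huc : ∀ t ∈ I, z.u t ∈ conf Ω W (k : ℕ) := fun t ht =>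
    mem_of_hasDerivWithinAt_mem (V := confSub hK hW (k : ℕ)) hI hI'
      (fun t ht => hu' t ht ▸ (h.diff_u t ht).hasDerivWithinAt) hp h₀
      (h.initial.mem_conf hK hW (h.mem.u_mem t₀ h₀)) ht
  have hρ₀ := h.initial.isRho hK hW (h.mem.u_mem t₀ h₀) (h.mem.ρ_mem t₀ h₀)
  have hρc : ∀ t ∈ I, z.ρ t ∈ conf Ω W ((k : ℕ) + 1) := fun t ht =>
    mem_of_hasDerivWithinAt_mem (V := confSub hK hW ((k : ℕ) + 1)) hI hI'
      (fun t ht => hρ' t ht ▸ (h.diff_ρ t ht).hasDerivWithinAt)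
      (fun t ht => (confSub hK hW ((k : ℕ) + 1)).neg_mem (brokenD_mem_conf hK hW (hp t ht))) h₀
      hρ₀.1 ht
  refine ⟨hσ, huc, hρc, hp, h.diff_σ, h.diff_u, h.diff_ρ, h.diff_p, fun t ht τ hτ => ?_,
    fun t ht r _ => by rw [hu' t ht], fun t ht η _ => ?_, fun t ht => ?_,
    h.initial.isSigma hK hW (hσ t₀ h₀), hρ₀⟩
  · have h1 := h.eq_σ t ht τ hτ.1
    rw [h.cons_p t ht _ (tanT_mem_confTrace hτ), hK.ipT_res_dT, ← hK.ip_eq_ipT, sub_zero] at h1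
    rw [weakD_eq_brokenD hK hW hτ, h1]
  · rw [hρ' t ht, weakD_eq_brokenD hK hW (hp t ht)]
    simp only [ip_eq_pairL, map_neg, LinearMap.neg_apply, neg_add_cancel]
  · have h1 := h.eq_p t ht
    rw [(h.flux_σ t ht).eq hK hW (h.σt_mem t ht).1 (h.mem.σ_mem t ht)] at h1
    exact h1.confEqP hK hW (hσ t ht) (h.cons_ρ t ht)

/-- The source term as a functional on the broken space. -/
noncomputable def sourceOn (hK : IsMesh Ω K)
    (hF : IsRegularPotential F I (broken Ω W (k : ℕ))) {t : ℝ} (ht : t ∈ I) {u : L2 Ω}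
    (hu : u ∈ broken Ω W (k : ℕ)) : brokenSub hK W (k : ℕ) →ₗ[ℝ] ℝ where
  toFun v := source F t u (v : L2 Ω)
  map_add' _ _ := source_add hF ht hu _ _
  map_smul' r _ := source_smul t u r _

/-- The conservative trace `ρ̂ⁿᵒʳ` exists. -/
theorem ConfEqP.exists_trace (hK : IsMesh Ω K) (hW : IsLocalComplex K W)
    (hF : IsRegularPotential F I (broken Ω W (k : ℕ))) {t : ℝ} (ht : t ∈ I) {u p' σ ρ : L2 Ω}
    (hu : u ∈ broken Ω W (k : ℕ)) (hσ : σ ∈ conf Ω W ((k : ℕ) - 1))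
    (h : ConfEqP W k F t u p' σ ρ) :
    ∃ ρn ∈ traceSpace W (k : ℕ), EqP W k F t u p' σ ρ (tanT K σ) ρn ∧
      Conservative W (k : ℕ) ρn := by
  obtain ⟨E, hE⟩ := HodgeWave.exists_trace hK hW (k : ℕ)
  let B := pairL ((volume : Measure (Space n)).restrict Ω)
  let l : brokenSub hK W (k : ℕ) →ₗ[ℝ] ℝ :=
    (-B p' + B (brokenD K σ)).comp (brokenSub hK W (k : ℕ)).subtype +
      (B ρ).comp (brokenDL hK hW (k : ℕ)) - sourceOn hK hF ht hu
  have hl : ∀ v : brokenSub hK W (k : ℕ), l v = -ip Ω p' (v : L2 Ω) +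
      ip Ω (brokenD K σ) (v : L2 Ω) + ip Ω ρ (brokenD K (v : L2 Ω)) - source F t u (v : L2 Ω) :=
    fun v => rfl
  have hl0 : ∀ v : brokenSub hK W (k : ℕ), (v : L2 Ω) ∈ conf Ω W (k : ℕ) → l v = 0 := by
    intro v hv
    have h1 := h v hv
    rw [weakD_eq_brokenD hK hW hσ, weakD_eq_brokenD hK hW hv] at h1
    rw [hl, h1, sub_self]
  refine ⟨E l, (hE l).1, fun v hv => ?_, fun g hg => ?_⟩
  · have h1 := (hE l).2 hl0 ⟨v, hv⟩
    rw [hl] at h1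
    have h2 := ipT_deltaT_add_tanT hK hW hσ.1 hv
    rw [h1, hK.ipT_res_dT, ← hK.ip_eq_ipT]
    linarith
  · obtain ⟨v, hv, rfl⟩ := (mem_confTrace_iff hK).1 hg
    exact ((hE l).2 hl0 ⟨v, hv.1⟩).trans (hl0 _ hv)

theorem IsAFW1.exists_isAFWH (hI : I.OrdConnected) (hI' : I.Nontrivial) (hK : IsMesh Ω K)
    (hW : IsLocalComplex K W) (hF : IsRegularPotential F I (broken Ω W (k : ℕ)))
    (h : IsAFW1 W k F I z) : ∃ y, IsAFWH W k F I z y := by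
  have hu := uniqueDiffOn_of_ordConnected hI hI'
  have hfin := finiteDimensional_confSub hK hW
  obtain ⟨t₀, h₀⟩ := hI'.nonempty
  have h2 := h.isAFW2 hI hI' hK hW h₀
  have hσd : ∀ t ∈ I, HasDerivWithinAt z.σ (derivWithin z.σ I t) I t := fun t ht =>
    (h2.diff_σ t ht).hasDerivWithinAt
  have hσ' : ∀ t ∈ I, derivWithin z.σ I t ∈ conf Ω W ((k : ℕ) - 1) := fun t ht =>
    hasDerivWithinAt_mem (V := confSub hK hW ((k : ℕ) - 1)) hu ht h2.σ_mem (hσd t ht)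
  have hρ' : ∀ t ∈ I, derivWithin z.ρ I t = -brokenD K (z.p t) := fun t ht => by
    refine eq_of_forall_ip (V := confSub hK hW ((k : ℕ) + 1))
      (hasDerivWithinAt_mem (V := confSub hK hW ((k : ℕ) + 1)) hu ht h2.ρ_mem
        (h2.diff_ρ t ht).hasDerivWithinAt)
      ((confSub hK hW ((k : ℕ) + 1)).neg_mem (brokenD_mem_conf hK hW (h.p_mem t ht)))
      fun η hη => ?_
    have h3 := h2.eq_ρ t ht η hη
    rw [weakD_eq_brokenD hK hW (h.p_mem t ht)] at h3
    simp only [ip_eq_pairL, map_neg, LinearMap.neg_apply] at h3 ⊢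
    linarith
  obtain ⟨E, hE⟩ := HodgeWave.exists_trace hK hW ((k : ℕ) - 1)
  let B := pairL ((volume : Measure (Space n)).restrict Ω)
  let A₁ : L2 Ω →ₗ[ℝ] ((i : ι) → L2B (K i)) := E.comp (B.compl₂ (brokenDL hK hW ((k : ℕ) - 1)))
  let A₂ : L2 Ω →ₗ[ℝ] ((i : ι) → L2B (K i)) :=
    E.comp (B.compl₂ (brokenSub hK W ((k : ℕ) - 1)).subtype)
  have hA : ∀ a b : L2 Ω, (∀ τ ∈ conf Ω W ((k : ℕ) - 1), ip Ω b τ + ip Ω a (weakD τ) = 0) →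
      A₁ a + A₂ b ∈ traceSpace W ((k : ℕ) - 1) ∧
      Conservative W ((k : ℕ) - 1) (A₁ a + A₂ b) ∧
      ∀ τ ∈ broken Ω W ((k : ℕ) - 1),
        ipBT (A₁ a + A₂ b) (tanT K τ) = ip Ω b τ + ip Ω a (brokenD K τ) := by
    intro a b hab
    let l := B.compl₂ (brokenDL hK hW ((k : ℕ) - 1)) a +
      B.compl₂ (brokenSub hK W ((k : ℕ) - 1)).subtype b
    have hl : ∀ τ : brokenSub hK W ((k : ℕ) - 1),
        l τ = ip Ω a (brokenD K (τ : L2 Ω)) + ip Ω b (τ : L2 Ω) := fun τ => rfl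
    have hl0 : ∀ τ : brokenSub hK W ((k : ℕ) - 1),
        (τ : L2 Ω) ∈ conf Ω W ((k : ℕ) - 1) → l τ = 0 := by
      intro τ hτ
      have h3 := hab τ hτ
      rw [weakD_eq_brokenD hK hW hτ] at h3
      rw [hl, add_comm, h3]
    have hEl : A₁ a + A₂ b = E l := (map_add E _ _).symm
    rw [hEl]
    refine ⟨(hE l).1, fun g hg => ?_, fun τ hτ => ?_⟩
    · obtain ⟨τ, hτ, rfl⟩ := (mem_confTrace_iff hK).1 hg
      exact ((hE l).2 hl0 ⟨τ, hτ.1⟩).trans (hl0 _ hτ)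
    · exact ((hE l).2 hl0 ⟨τ, hτ⟩).trans ((hl _).trans (add_comm _ _))
  have hAu : ∀ t ∈ I, _ := fun t ht => hA (z.u t) (z.σ t) fun τ hτ => by
    have h3 := (h.eq_σ t ht).2 τ hτ
    linarith
  have hAp : ∀ t ∈ I, _ := fun t ht => hA (z.p t) (derivWithin z.σ I t) (h2.eq_σ t ht)
  have hρn : ∀ t, ∃ g, t ∈ I → g ∈ traceSpace W (k : ℕ) ∧
      EqP W k F t (z.u t) (derivWithin z.p I t) (z.σ t) (z.ρ t) (tanT K (z.σ t)) g ∧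
      Conservative W (k : ℕ) g := by
    intro t
    by_cases ht : t ∈ I
    · obtain ⟨g, hg, hg'⟩ := (h.eq_p t ht).exists_trace hK hW hF ht (h.u_mem t ht).1 (h2.σ_mem t ht)
      exact ⟨g, fun _ => ⟨hg, hg'⟩⟩
    · exact ⟨0, fun h => absurd h ht⟩
  choose ρn hρn using hρn
  have hud : ∀ t ∈ I, HasDerivWithinAt z.u (z.p t) I t := fun t ht =>
    h.hasDerivWithinAt_u hI hI' hK hW ht
  refine ⟨⟨fun t => tanT K (z.σ t), fun t => tanT K (z.u t), fun t => tanT K (z.p t),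
    fun t => A₁ (z.u t) + A₂ (z.σ t), fun t => A₁ (z.p t) + A₂ (derivWithin z.σ I t), ρn⟩, ?_⟩
  exact
    { mem := ⟨fun t ht => (h2.σ_mem t ht).1, fun t ht => (h.u_mem t ht).1,
        fun t ht => (h2.ρ_mem t ht).1, fun t ht => (h.p_mem t ht).1⟩
      σt_mem := fun t ht => tanT_mem_confTrace (h2.σ_mem t ht)
      ut_mem := fun t ht => tanT_mem_confTrace (h.u_mem t ht)
      pt_mem := fun t ht => tanT_mem_confTrace (h.p_mem t ht)
      un_mem := fun t ht => (hAu t ht).1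
      pn_mem := fun t ht => (hAp t ht).1
      ρn_mem := fun t ht => (hρn t ht).1
      diff_σ := h2.diff_σ
      diff_u := h.diff_u
      diff_ρ := h2.diff_ρ
      diff_p := h.diff_p
      deriv_ut := fun t ht => hasDerivWithinAt_of_linear (V := confSub hK hW (k : ℕ))
        ((tanTL hK hW (k : ℕ)).comp (Submodule.inclusion (confSub_le hK hW (k : ℕ)))) ht h.u_mem
        (hud t ht) (h.p_mem t ht) fun _ _ => rfl
      deriv_un := fun t ht =>
        (hasDerivWithinAt_of_linear (V := confSub hK hW (k : ℕ))
          (A₁.comp (confSub hK hW (k : ℕ)).subtype) ht h.u_mem (hud t ht) (h.p_mem t ht)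
          fun _ _ => rfl).add
        (hasDerivWithinAt_of_linear (V := confSub hK hW ((k : ℕ) - 1))
          (A₂.comp (confSub hK hW ((k : ℕ) - 1)).subtype) ht h2.σ_mem (hσd t ht) (hσ' t ht)
          fun _ _ => rfl)
      eq_σ := fun t ht τ hτ => by
        rw [(hAp t ht).2.2 τ hτ, hK.ipT_res_dT, ← hK.ip_eq_ipT, sub_self]
      eq_u := fun t ht r _ => by rw [h.deriv_u hI hI' hK hW ht]
      eq_ρ := fun t ht => (eqRhoDot_iff hK hW (h.p_mem t ht).1 (by
        rw [hρ' t ht]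
        exact (brokenSub hK W ((k : ℕ) + 1)).neg_mem (brokenD_mem hK hW (h.p_mem t ht).1))).2
          (hρ' t ht)
      eq_tau := fun t ht τ hτ => by
        rw [(hAu t ht).2.2 τ hτ, hK.ipT_res_dT, ← hK.ip_eq_ipT]
        ring
      eq_p := fun t ht => (hρn t ht).2.1
      eq_eta := fun t ht => (eqEta_iff hK hW (h.u_mem t ht).1 (h2.ρ_mem t ht).1).2
        ((isRho_iff_neg hK hW (h.u_mem t ht)).1 (h.eq_ρ t ht))
      flux_σ := fun t _ => flux_tanT _
      flux_u := fun t _ => flux_tanT _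
      flux_p := fun t _ => flux_tanT _
      cons_u := fun t ht => (hAu t ht).2.1
      cons_p := fun t ht => (hAp t ht).2.1
      cons_ρ := fun t ht => (hρn t ht).2.2 }

/-- The traces of a solution of the hybrid method are determined by the interior unknowns. -/
theorem IsAFWH.traces_unique (hK : IsMesh Ω K) (hW : IsLocalComplex K W) {y' : TraceCurves K}
    (h : IsAFWH W k F I z y) (h' : IsAFWH W k F I z y') {t : ℝ} (ht : t ∈ I) :
    y.σt t = y'.σt t ∧ y.ut t = y'.ut t ∧ y.pt t = y'.pt t ∧
      y.un t = y'.un t ∧ y.pn t = y'.pn t ∧ y.ρn t = y'.ρn t := by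
  have hσ : ∀ {y}, IsAFWH W k F I z y → y.σt t = tanT K (z.σ t) := fun h =>
    (h.flux_σ t ht).eq hK hW (h.σt_mem t ht).1 (h.mem.σ_mem t ht)
  have hu : ∀ {y}, IsAFWH W k F I z y → y.ut t = tanT K (z.u t) := fun h =>
    (h.flux_u t ht).eq hK hW (h.ut_mem t ht).1 (h.mem.u_mem t ht)
  have hp : ∀ {y}, IsAFWH W k F I z y → y.pt t = tanT K (z.p t) := fun h =>
    (h.flux_p t ht).eq hK hW (h.pt_mem t ht).1 (h.mem.p_mem t ht)
  refine ⟨(hσ h).trans (hσ h').symm, (hu h).trans (hu h').symm, (hp h).trans (hp h').symm,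
    eq_of_forall_ipBT hK hW (h.un_mem t ht) (h'.un_mem t ht) fun τ hτ => ?_,
    eq_of_forall_ipBT hK hW (h.pn_mem t ht) (h'.pn_mem t ht) fun τ hτ => ?_,
    eq_of_forall_ipBT hK hW (h.ρn_mem t ht) (h'.ρn_mem t ht) fun v hv => ?_⟩
  · have h1 := h.eq_tau t ht τ hτ
    have h2 := h'.eq_tau t ht τ hτ
    linarith
  · have h1 := h.eq_σ t ht τ hτ
    have h2 := h'.eq_σ t ht τ hτ
    linarith
  · have h1 := h.eq_p t ht v hv
    have h2 := h'.eq_p t ht v hv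
    rw [(hσ h).trans (hσ h').symm] at h1
    linarith

end Hybrid

end HodgeWave

theorem mainTheorem10 {n : ℕ} {ι : Type*} [Fintype ι]
    (Ω : Set (HodgeWave.Space n)) (K : ι → Set (HodgeWave.Space n))
    (hK : HodgeWave.IsMesh Ω K)
    (W : (i : ι) → ℤ → Submodule ℝ (HodgeWave.L2 (K i)))
    (hW : HodgeWave.IsLocalComplex K W)
    (k : Fin (n + 1)) (I : Set ℝ) (hI : I.OrdConnected) (hI' : I.Nontrivial)
    (F : HodgeWave.Potential n k)
    (hF : HodgeWave.IsRegularPotential F I (HodgeWave.broken Ω W (k : ℕ))) :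
    -- the conforming spaces consist of forms with a distributional differential on the domain
    (∀ j : ℤ, ∀ w ∈ HodgeWave.conf Ω W j, HodgeWave.InH w) ∧
    -- the constraints determine the two auxiliary variables
    (∀ u ∈ HodgeWave.conf Ω W (k : ℕ),
      (∃! σ, HodgeWave.IsSigma W k u σ) ∧ (∃! ρ, HodgeWave.IsRho W k u ρ) ∧
      HodgeWave.IsSigma W k u (HodgeWave.sigmaOf W k u) ∧
      HodgeWave.IsRho W k u (HodgeWave.rhoOf W k u)) ∧
    -- equivalence of every form of the method with Hamilton's equations
    (∀ z : HodgeWave.Curves Ω,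
      (HodgeWave.IsAFW1 W k F I z ↔
        HodgeWave.IsHamiltonian W k F I z.u z.p ∧ HodgeWave.IsRecovered W k I z) ∧
      (∀ t₀ ∈ I, (HodgeWave.IsAFW2 W k F I t₀ z ↔
        HodgeWave.IsHamiltonian W k F I z.u z.p ∧ HodgeWave.IsRecovered W k I z)) ∧
      ((∃ y, HodgeWave.IsAFWH W k F I z y) ↔
        HodgeWave.IsHamiltonian W k F I z.u z.p ∧ HodgeWave.IsRecovered W k I z) ∧
      ((∃ y, HodgeWave.IsAFWH1 W k F I z y) ↔
        HodgeWave.IsHamiltonian W k F I z.u z.p ∧ HodgeWave.IsRecovered W k I z) ∧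
      (∀ t₀ ∈ I, ((∃ y, HodgeWave.IsAFWH2 W k F I t₀ z y) ↔
        HodgeWave.IsHamiltonian W k F I z.u z.p ∧ HodgeWave.IsRecovered W k I z))) ∧
    -- the trace variables are determined as well
    (∀ (z : HodgeWave.Curves Ω) (y y' : HodgeWave.TraceCurves K),
      HodgeWave.IsAFWH W k F I z y → HodgeWave.IsAFWH W k F I z y' →
      ∀ t ∈ I, y.σt t = y'.σt t ∧ y.ut t = y'.ut t ∧ y.pt t = y'.pt t ∧
        y.un t = y'.un t ∧ y.pn t = y'.pn t ∧ y.ρn t = y'.ρn t) := by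
  refine ⟨fun j w hw => ⟨_, HodgeWave.hasWeakD_brokenD hK hW hw⟩, fun u hu => ?_, fun z => ?_,
    fun z y y' h h' t ht => h.traces_unique hK hW h' ht⟩
  · have hσ := HodgeWave.isSigma_sigmaOf hK hW (k := k) u
    have hρ := (HodgeWave.isRho_iff hK hW hu).2 rfl
    exact ⟨⟨_, hσ, fun σ h => (HodgeWave.isSigma_iff hK hW).1 h⟩,
      ⟨_, hρ, fun ρ h => (HodgeWave.isRho_iff hK hW hu).1 h⟩, hσ, hρ⟩
  · rw [← HodgeWave.isAFW1_iff hK hW hF]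
    refine ⟨Iff.rfl, fun t₀ h₀ => ⟨fun h => h.isAFW1 hI hI' hK hW h₀,
        fun h => h.isAFW2 hI hI' hK hW h₀⟩,
      ⟨fun ⟨_, h⟩ => h.isAFWH1.isAFW1 hI hI' hK hW, fun h => h.exists_isAFWH hI hI' hK hW hF⟩,
      ⟨fun ⟨_, h⟩ => h.isAFW1 hI hI' hK hW, fun h => ?_⟩,
      fun t₀ h₀ => ⟨fun ⟨_, h⟩ => (h.isAFW2 hI hI' hK hW h₀).isAFW1 hI hI' hK hW h₀,
        fun h => ?_⟩⟩
    · obtain ⟨y, hy⟩ := h.exists_isAFWH hI hI' hK hW hF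
      exact ⟨y, hy.isAFWH1⟩
    · obtain ⟨y, hy⟩ := h.exists_isAFWH hI hI' hK hW hF
      exact ⟨y, hy.isAFWH2 h₀⟩
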